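/- Consider the real linear system $\dot x = Ax+Bu$, $y=Cx+Du$ whose state, input and output are partitioned into $n$, $n_i$ and $n_o$ blocks, of sizes $k_i$ ($1\le i\le n$), $m_l$ ($1\le l\le n_i$) and $p_k$ ($1\le k\le n_o$), with corresponding blocks $A_{ij}$, $B_{il}$, $C_{ki}$, $D_{kl}$. Assume that every $A_{ii}$ is Hurwitz (all eigenvalues have negative real part). For a stable transfer function $T$ let $\|T\|_{\mathcal H_\infty}=\sup_{\omega\in\mathbb R}\|T(\imath\omega)\|_2$, where $\|\cdot\|_2$ is the spectral norm. Define the comparison system $(F,G,H,J)$ by $F_{ii}=-1$, $F_{ij}=\|(sI-A_{ii})^{-1}A_{ij}\|_{\mathcal H_\infty}$ for $i\ne j$, $G_{il}=\|(sI-A_{ii})^{-1}B_{il}\|_{\mathcal H_\infty}$, $H_{ki}=\|C_{ki}\|_2$, $J_{kl}=\|D_{kl}\|_2$. Let $\mathcal K_i=\{k:\ C_{ki}\neq0\}$, $\mathcal L_i=\{l:\ B_{il}\ne0\}$, $\mathcal I_i=\{j\ne i:\ A_{ij}\neq 0\}$. Suppose that $F$ is Hurwitz and $\|H(sI-F)^{-1}G+J\|_{\mathcal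 H_\infty}<\delta$. Then there exist symmetric matrices $P_i\succ0$ and $\Xi_{ki},\Gamma_{il},\Phi_{ij},\Upsilon_{kl},\Lambda_{kl}\succeq0$, where $\Xi_{ki}$ (for $k\in\mathcal K_i$), $\Gamma_{il}$ (for $l\in\mathcal L_i$) and $\Phi_{ij}$ (for $j\in\mathcal I_i$) are invertible, such that (a) for all $i$: $\ P_iA_{ii}+A_{ii}^{\mathsf T}P_i+\sum_{j\ne i}\Phi_{ji}+\sum_{k\in\mathcal K_i}C_{ki}^{\mathsf T}\Xi_{ki}^{-1}C_{ki}+P_i\Big(\sum_{j\in\mathcal I_i}A_{ij}\Phi_{ij}^{-1}A_{ij}^{\mathsf T}+\sum_{l\in\mathcal L_i}B_{il}\Gamma_{il}^{-1}B_{il}^{\mathsf T}\Big)P_i\prec0$; (b) for all $k,l$: $\ \begin{bmatrix}\Upsilon_{kl}&-D_{kl}^{\mathsf T}\\-D_{kl}&\Lambda_{kl}\end{bmatrix}\succeq0$; (c) for all $k$: $\ \sum_{i=1}^n\Xi_{ki}+\sum_{l=1}^{n_i}\Lambda_{kl}\preceq I$; (d) for all $l$: $\ \sum_{i=1}^n\Gamma_{il}+\sum_{k=1}^{n_o}\Upsilon_{kl}\prec\delta^2I$.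 Such matrices can be constructed as follows. There exist entrywise positive vectors $d,e\in\mathbb R^n$, $g\in\mathbb R^{n_o}$, $f\in\mathbb R^{n_i}$ with $$Fd+Gf<0,\qquad Hd+Jf\le g,\qquad F^{\mathsf T}e+H^{\mathsf T}g<0,\qquad G^{\mathsf T}e+J^{\mathsf T}g<\delta^2f$$ (entrywise inequalities). For any such vectors put $\Xi_{ki}=\frac{H_{ki}d_i}{g_k}I$, $\Gamma_{il}=\frac{G_{il}e_i}{f_l}I$, $\Phi_{ij}=\frac{|F_{ij}|e_i}{d_j}I$, $\Upsilon_{kl}=\frac{J_{kl}g_k}{f_l}I$, $\Lambda_{kl}=\frac{J_{kl}f_l}{g_k}I$. Then for each $i$ the Riccati equation $$P_iA_{ii}+A_{ii}^{\mathsf T}P_i+\frac{e_i}{d_i}I+P_i\Big(\sum_{j\in\mathcal I_i}A_{ij}\Phi_{ij}^{-1}A_{ij}^{\mathsf T}+\sum_{l\in\mathcal L_i}B_{il}\Gamma_{il}^{-1}B_{il}^{\mathsf T}\Big)P_i=0$$ has a solution $P_i\succ0$, and for any choice of such solutions these matrices satisfy all of the requirements above, including (a)–(d). -/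

import Mathlib

noncomputable section

namespace BlockRiccati

open scoped Matrix.Norms.L2Operator in
/-- The spectral norm `‖M‖₂` (largest singular value), i.e. the operator norm of `M` between
Euclidean spaces. -/
def specNorm {𝕜 : Type} [RCLike 𝕜] {a b : Type} [Fintype a] [Fintype b] [DecidableEq b]
    (M : Matrix a b 𝕜) : ℝ := ‖M‖

/-- A real matrix regarded as a complex one. -/
abbrev toC {a b : Type} (M : Matrix a b ℝ) : Matrix a b ℂ := M.map Complex.ofReal

/-- All complex eigenvalues have negative real part. -/
def IsHurwitz {a : Type} [Fintype a] [DecidableEq a] (A : Matrix a a ℝ) : Prop :=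
  ∀ z ∈ spectrum ℂ (toC A), z.re < 0

/-- `(s I - A)⁻¹`; a genuine inverse whenever `s` is not an eigenvalue of `A`. -/
def resolventMat {a : Type} [Fintype a] [DecidableEq a] (A : Matrix a a ℝ) (s : ℂ) :
    Matrix a a ℂ := (s • (1 : Matrix a a ℂ) - toC A)⁻¹

/-- The `H∞` norm `sup_ω ‖T(iω)‖₂` of a transfer function. It is only applied to stable, proper,
rational transfer functions, for which the supremum is over a bounded set. -/
def hinfNorm {a b : Type} [Fintype a] [Fintype b] [DecidableEq b] (T : ℂ → Matrix a b ℂ) : ℝ :=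
  ⨆ ω : ℝ, specNorm (T (Complex.I * (ω : ℂ)))

/-- The transfer function `C (s I - A)⁻¹ B + D`. -/
def transferFn {x u y : Type} [Fintype x] [DecidableEq x]
    (A : Matrix x x ℝ) (B : Matrix x u ℝ) (C : Matrix y x ℝ) (D : Matrix y u ℝ) (s : ℂ) :
    Matrix y u ℂ := toC C * resolventMat A s * toC B + toC D

/-- `X ≻ Y` for real symmetric matrices: `X - Y` is (symmetric) positive definite. -/
abbrev LoewnerGT {a : Type} (X Y : Matrix a a ℝ) : Prop := (X - Y).PosDef

/-- `X ⪰ Y` for real symmetric matrices: `X - Y` is (symmetric) positive semidefinite. -/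
abbrev LoewnerGE {a : Type} (X Y : Matrix a a ℝ) : Prop := (X - Y).PosSemidef

/-- The `(i, j)` block of a block-partitioned matrix. -/
def blk {r c : ℕ} {h : Fin r → ℕ} {w : Fin c → ℕ}
    (M : Matrix (Σ i, Fin (h i)) (Σ j, Fin (w j)) ℝ) (i : Fin r) (j : Fin c) :
    Matrix (Fin (h i)) (Fin (w j)) ℝ := Matrix.of fun a b => M ⟨i, a⟩ ⟨j, b⟩

/-- A linear time-invariant system `x' = A x + B u`, `y = C x + D u` whose state, input and output
are partitioned into `n`, `ni` and `no` blocks of sizes `k i`, `m l` and `p q`. -/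
structure PartitionedSystem {n ni no : ℕ}
    (k : Fin n → ℕ) (m : Fin ni → ℕ) (p : Fin no → ℕ) where
  A : Matrix (Σ i, Fin (k i)) (Σ i, Fin (k i)) ℝ
  B : Matrix (Σ i, Fin (k i)) (Σ l, Fin (m l)) ℝ
  C : Matrix (Σ q, Fin (p q)) (Σ i, Fin (k i)) ℝ
  D : Matrix (Σ q, Fin (p q)) (Σ l, Fin (m l)) ℝ

namespace PartitionedSystem

variable {n ni no : ℕ} {k : Fin n → ℕ} {m : Fin ni → ℕ} {p : Fin no → ℕ}

/-! The comparison system `(F, G, H, J)`. -/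

def F (S : PartitionedSystem k m p) : Matrix (Fin n) (Fin n) ℝ :=
  Matrix.of fun i j => if i = j then -1 else
    hinfNorm fun s => resolventMat (blk S.A i i) s * toC (blk S.A i j)

def G (S : PartitionedSystem k m p) : Matrix (Fin n) (Fin ni) ℝ :=
  Matrix.of fun i l => hinfNorm fun s => resolventMat (blk S.A i i) s * toC (blk S.B i l)

def H (S : PartitionedSystem k m p) : Matrix (Fin no) (Fin n) ℝ :=
  Matrix.of fun q i => specNorm (blk S.C q i)

def J (S : PartitionedSystem k m p) : Matrix (Fin no) (Fin ni) ℝ :=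
  Matrix.of fun q l => specNorm (blk S.D q l)

/-! The index sets of nonzero blocks. -/

open Classical in
def setK (S : PartitionedSystem k m p) (i : Fin n) : Finset (Fin no) :=
  Finset.univ.filter fun q => specNorm (blk S.C q i) ≠ 0

open Classical in
def setL (S : PartitionedSystem k m p) (i : Fin n) : Finset (Fin ni) :=
  Finset.univ.filter fun l => specNorm (blk S.B i l) ≠ 0

open Classical in
def setI (S : PartitionedSystem k m p) (i : Fin n) : Finset (Fin n) :=
  Finset.univ.filter fun j => specNorm (blk S.A i j) ≠ 0 ∧ j ≠ i

/-- The quadratic term `∑_{j ∈ I_i} A_ij Φ_ij⁻¹ A_ijᵀ + ∑_{l ∈ L_i} B_il Γ_il⁻¹ B_ilᵀ`. -/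
def quadTerm (S : PartitionedSystem k m p)
    (Φ : (i j : Fin n) → Matrix (Fin (k j)) (Fin (k j)) ℝ)
    (Γ : (i : Fin n) → (l : Fin ni) → Matrix (Fin (m l)) (Fin (m l)) ℝ) (i : Fin n) :
    Matrix (Fin (k i)) (Fin (k i)) ℝ :=
  ∑ j ∈ S.setI i, blk S.A i j * (Φ i j)⁻¹ * (blk S.A i j).transpose +
    ∑ l ∈ S.setL i, blk S.B i l * (Γ i l)⁻¹ * (blk S.B i l).transpose

/-- `(P, Ξ, Γ, Φ, Υ, Λ)` satisfies the decoupled block Riccati inequalities together with the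
coupling linear matrix inequalities. The three `_pos` fields say that every matrix whose inverse is
taken is invertible (for a positive semidefinite matrix this means positive definite). -/
structure Feasible (S : PartitionedSystem k m p) (δ : ℝ)
    (P : (i : Fin n) → Matrix (Fin (k i)) (Fin (k i)) ℝ)
    (Ξ : (q : Fin no) → (i : Fin n) → Matrix (Fin (p q)) (Fin (p q)) ℝ)
    (Γ : (i : Fin n) → (l : Fin ni) → Matrix (Fin (m l)) (Fin (m l)) ℝ)
    (Φ : (i j : Fin n) → Matrix (Fin (k j)) (Fin (k j)) ℝ)
    (Υ : (q : Fin no) → (l : Fin ni) → Matrix (Fin (m l)) (Fin (m l)) ℝ)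
    (Λ : (q : Fin no) → (l : Fin ni) → Matrix (Fin (p q)) (Fin (p q)) ℝ) : Prop where
  posDef_P : ∀ i, (P i).PosDef
  psd_Ξ : ∀ q i, (Ξ q i).PosSemidef
  psd_Γ : ∀ i l, (Γ i l).PosSemidef
  psd_Φ : ∀ i j, (Φ i j).PosSemidef
  psd_Υ : ∀ q l, (Υ q l).PosSemidef
  psd_Λ : ∀ q l, (Λ q l).PosSemidef
  Ξ_pos : ∀ i, ∀ q ∈ S.setK i, (Ξ q i).PosDef
  Γ_pos : ∀ i, ∀ l ∈ S.setL i, (Γ i l).PosDef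
  Φ_pos : ∀ i, ∀ j ∈ S.setI i, (Φ i j).PosDef
  riccati : ∀ i, LoewnerGT 0
    (P i * blk S.A i i + (blk S.A i i).transpose * P i
      + ∑ j ∈ Finset.univ.erase i, Φ j i
      + ∑ q ∈ S.setK i, (blk S.C q i).transpose * (Ξ q i)⁻¹ * blk S.C q i
      + P i * S.quadTerm Φ Γ i * P i)
  coupling_D : ∀ q l, LoewnerGE
    (Matrix.fromBlocks (Υ q l) (-(blk S.D q l).transpose) (-(blk S.D q l)) (Λ q l)) 0
  coupling_out : ∀ q, LoewnerGE 1 (∑ i, Ξ q i + ∑ l, Λ q l)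
  coupling_in : ∀ l, LoewnerGT (δ ^ 2 • (1 : Matrix (Fin (m l)) (Fin (m l)) ℝ))
    (∑ i, Γ i l + ∑ q, Υ q l)

/-- `(d, e, g, f)` is an entrywise positive solution of the linear program
`F d + G f < 0`, `H d + J f ≤ g`, `Fᵀ e + Hᵀ g < 0`, `Gᵀ e + Jᵀ g < δ² f`. -/
structure LPSolution (S : PartitionedSystem k m p) (δ : ℝ)
    (d e : Fin n → ℝ) (g : Fin no → ℝ) (f : Fin ni → ℝ) : Prop where
  d_pos : ∀ i, 0 < d i
  e_pos : ∀ i, 0 < e i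
  g_pos : ∀ q, 0 < g q
  f_pos : ∀ l, 0 < f l
  state : ∀ i, (S.F.mulVec d + S.G.mulVec f) i < 0
  output : ∀ q, (S.H.mulVec d + S.J.mulVec f) q ≤ g q
  costate : ∀ i, (S.F.transpose.mulVec e + S.H.transpose.mulVec g) i < 0
  input : ∀ l, (S.G.transpose.mulVec e + S.J.transpose.mulVec g) l < δ ^ 2 * f l

/-! The scaled identities built from a solution of the linear program. -/

def lpΞ (S : PartitionedSystem k m p) (d : Fin n → ℝ) (g : Fin no → ℝ)
    (q : Fin no) (i : Fin n) : Matrix (Fin (p q)) (Fin (p q)) ℝ := (S.H q i * d i / g q) • 1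

def lpΓ (S : PartitionedSystem k m p) (e : Fin n → ℝ) (f : Fin ni → ℝ)
    (i : Fin n) (l : Fin ni) : Matrix (Fin (m l)) (Fin (m l)) ℝ := (S.G i l * e i / f l) • 1

def lpΦ (S : PartitionedSystem k m p) (d e : Fin n → ℝ)
    (i j : Fin n) : Matrix (Fin (k j)) (Fin (k j)) ℝ := (|S.F i j| * e i / d j) • 1

def lpΥ (S : PartitionedSystem k m p) (g : Fin no → ℝ) (f : Fin ni → ℝ)
    (q : Fin no) (l : Fin ni) : Matrix (Fin (m l)) (Fin (m l)) ℝ := (S.J q l * g q / f l) • 1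

def lpΛ (S : PartitionedSystem k m p) (g : Fin no → ℝ) (f : Fin ni → ℝ)
    (q : Fin no) (l : Fin ni) : Matrix (Fin (p q)) (Fin (p q)) ℝ := (S.J q l * f l / g q) • 1

/-- The per-block Riccati equation
`X A_ii + A_iiᵀ X + φ_ii I + X (∑_{j ∈ I_i} A_ij φ_ij⁻¹ A_ijᵀ + ∑_{l ∈ L_i} B_il γ_il⁻¹ B_ilᵀ) X = 0`,
where `φ_ii = e_i / d_i`. -/
def BlockRiccatiEq (S : PartitionedSystem k m p) (d e : Fin n → ℝ) (f : Fin ni → ℝ)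
    (i : Fin n) (X : Matrix (Fin (k i)) (Fin (k i)) ℝ) : Prop :=
  X * blk S.A i i + (blk S.A i i).transpose * X
    + (e i / d i) • (1 : Matrix (Fin (k i)) (Fin (k i)) ℝ)
    + X * S.quadTerm (S.lpΦ d e) (S.lpΓ e f) i * X = 0

end PartitionedSystem

end BlockRiccati

end

/-! Scalar multipliers reduce every matrix condition to one row of a linear program for the
comparison system.

The program is solved from its zero-frequency gain. As `F` is Hurwitz with nonnegative off-diagonal
entries, `X = (-F)⁻¹` is entrywise nonnegative, and so is `M = H X G + J`, with `‖M‖ < δ`. A Neumann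
series for `1 - δ⁻² Mᵀ M` gives `f > 0` with `Mᵀ M f < δ² f`; `g` lies slightly above `M f`, and
`d`, `e` are `X` and `Xᵀ` applied to slight enlargements of `G f` and `Hᵀ g` (`exists_lp`).

Given a solution, let `Q` be the quadratic coefficient of block `i` and `R` the resolvent of `A_ii`
at `iω`. Then `‖R Q Rᴴ‖ ≤ (∑_{j ≠ i} F_ij d_j + ∑ G_il f_l) / e_i < d_i / e_i`, a strict small gain
condition for the Riccati equation with constant term `e_i / d_i`. It excludes imaginary eigenvalues
of the Hamiltonian, so the stable subspace is the graph of a real Hermitian solution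
(`exists_isHermitian_riccati`), positive definite by `posDef_of_lyapunov`. The costate row then
turns the equation into inequality (a), a Schur complement gives (b), and the output and input rows
are (c) and (d). -/

namespace BlockRiccati

open Module Matrix Filter Topology
open scoped ComplexOrder Matrix.Norms.L2Operator

/-! ### Stable subspaces of Hamiltonian operators and Hermitian Riccati solutions -/

section Hamiltonian

variable {ι : Type} [Fintype ι]

/-- The Hamiltonian operator of the Riccati equation `X A + Aᴴ X + c + X Q X = 0`. -/
def hamiltonian (A Q : Matrix ι ι ℂ) (c : ℝ) : Module.End ℂ ((ι → ℂ) × (ι → ℂ)) :=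
  (A.mulVecLin ∘ₗ LinearMap.fst ℂ _ _ + Q.mulVecLin ∘ₗ LinearMap.snd ℂ _ _).prod
    (-((c : ℂ) • LinearMap.fst ℂ _ _) - Aᴴ.mulVecLin ∘ₗ LinearMap.snd ℂ _ _)

@[simp] lemma hamiltonian_apply (A Q : Matrix ι ι ℂ) (c : ℝ) (v : (ι → ℂ) × (ι → ℂ)) :
    hamiltonian A Q c v = (A *ᵥ v.1 + Q *ᵥ v.2, -((c : ℂ) • v.1) - Aᴴ *ᵥ v.2) := rfl

/-- The standard skew-Hermitian form on `ℂⁿ × ℂⁿ`. -/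
def skewForm (v w : (ι → ℂ) × (ι → ℂ)) : ℂ := star v.1 ⬝ᵥ w.2 - star v.2 ⬝ᵥ w.1

lemma skewForm_add_left (v v' w : (ι → ℂ) × (ι → ℂ)) :
    skewForm (v + v') w = skewForm v w + skewForm v' w := by
  simp [skewForm]; ring

lemma skewForm_add_right (v w w' : (ι → ℂ) × (ι → ℂ)) :
    skewForm v (w + w') = skewForm v w + skewForm v w' := by
  simp [skewForm]; ring

lemma skewForm_smul_left (a : ℂ) (v w : (ι → ℂ) × (ι → ℂ)) :
    skewForm (a • v) w = star a * skewForm v w := by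
  simp [skewForm]; ring

lemma skewForm_smul_right (a : ℂ) (v w : (ι → ℂ) × (ι → ℂ)) :
    skewForm v (a • w) = a * skewForm v w := by
  simp [skewForm]; ring

lemma eq_zero_of_skewForm_eq_zero {v : (ι → ℂ) × (ι → ℂ)} (h : ∀ w, skewForm v w = 0) : v = 0 := by
  have h1 := h (0, v.1)
  have h2 := h (v.2, 0)
  simp only [skewForm, dotProduct_zero, sub_zero, zero_sub, neg_eq_zero,
    dotProduct_star_self_eq_zero] at h1 h2
  exact Prod.ext h1 h2

/-- The off-diagonal blocks `Q` and `-c` are Hermitian and the diagonal blocks are `A` and `-Aᴴ`, so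
the operator is skew-adjoint for the form. -/
lemma skewForm_hamiltonian {A Q : Matrix ι ι ℂ} (hQ : Q.IsHermitian) (c : ℝ)
    (v w : (ι → ℂ) × (ι → ℂ)) :
    skewForm (hamiltonian A Q c v) w = -skewForm v (hamiltonian A Q c w) := by
  have hQ' : Qᴴ = Q := hQ
  simp [skewForm, star_mulVec, dotProduct_mulVec, add_dotProduct, dotProduct_add, sub_dotProduct,
    dotProduct_sub, hQ']
  ring

/-- Induction on `a + b`: skew-adjointness expresses `(star μ + ν)` times the form through pairs in
which one vector has been hit by its nilpotent factor, and those pairings vanish by induction. -/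
lemma skewForm_eq_zero_of_pow {A Q : Matrix ι ι ℂ} (hQ : Q.IsHermitian) (c : ℝ) {μ ν : ℂ}
    (hμν : star μ + ν ≠ 0) (N : ℕ) : ∀ (a b : ℕ) (v w : (ι → ℂ) × (ι → ℂ)), a + b ≤ N →
      ((hamiltonian A Q c - μ • 1) ^ a) v = 0 → ((hamiltonian A Q c - ν • 1) ^ b) w = 0 →
      skewForm v w = 0 := by
  induction N with
  | zero =>
    intro a b v w hab hv hw
    obtain rfl : a = 0 := by omega
    simp at hv
    simp [hv, skewForm]
  | succ N ih =>
    intro a b v w hab hv hw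
    rcases a with _ | a
    · simp at hv
      simp [hv, skewForm]
    rcases b with _ | b
    · simp at hw
      simp [hw, skewForm]
    have h1 := ih a (b + 1) ((hamiltonian A Q c - μ • 1) v) w (by omega)
      (by rw [pow_succ] at hv; exact hv) hw
    have h2 := ih (a + 1) b v ((hamiltonian A Q c - ν • 1) w) (by omega) hv
      (by rw [pow_succ] at hw; exact hw)
    have e1 : hamiltonian A Q c v = (hamiltonian A Q c - μ • 1) v + μ • v := by
      rw [LinearMap.sub_apply, LinearMap.smul_apply, Module.End.one_apply, sub_add_cancel]
    have e2 : hamiltonian A Q c w = (hamiltonian A Q c - ν • 1) w + ν • w := by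
      rw [LinearMap.sub_apply, LinearMap.smul_apply, Module.End.one_apply, sub_add_cancel]
    have h3 := skewForm_hamiltonian (A := A) hQ c v w
    rw [e1, e2, skewForm_add_left, skewForm_add_right, skewForm_smul_left, skewForm_smul_right,
      h1, h2] at h3
    have h4 : (star μ + ν) * skewForm v w = 0 := by linear_combination h3
    exact (mul_eq_zero.mp h4).resolve_left hμν

/-- The sum of the generalized eigenspaces of `T` with eigenvalues in `s`. -/
def spectralSubspace {V : Type*} [AddCommGroup V] [Module ℂ V] (T : Module.End ℂ V) (s : Set ℂ) :
    Submodule ℂ V :=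
  ⨆ μ : s, T.maxGenEigenspace μ

lemma mem_spectralSubspace {V : Type*} [AddCommGroup V] [Module ℂ V] {T : Module.End ℂ V}
    {s : Set ℂ} {μ : ℂ} (hμ : μ ∈ s) {v : V} (hv : v ∈ T.maxGenEigenspace μ) :
    v ∈ spectralSubspace T s :=
  Submodule.mem_iSup_of_mem (p := fun μ : s => T.maxGenEigenspace μ) ⟨μ, hμ⟩ hv

lemma map_mem_spectralSubspace {V : Type*} [AddCommGroup V] [Module ℂ V] {T : Module.End ℂ V}
    {s : Set ℂ} {v : V} (hv : v ∈ spectralSubspace T s) : T v ∈ spectralSubspace T s := by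
  refine Submodule.iSup_induction _ (motive := fun v => T v ∈ spectralSubspace T s) hv ?_ ?_ ?_
  · intro μ x hx
    exact mem_spectralSubspace μ.2 (Module.End.mapsTo_maxGenEigenspace_of_comm rfl _ hx)
  · simp
  · intro x y hx hy
    rw [map_add]
    exact add_mem hx hy

lemma spectralSubspace_sup_eq_top {V : Type*} [AddCommGroup V] [Module ℂ V] [FiniteDimensional ℂ V]
    {T : Module.End ℂ V} {s t : Set ℂ} (h : ∀ μ, T.HasEigenvalue μ → μ ∈ s ∪ t) :
    spectralSubspace T s ⊔ spectralSubspace T t = ⊤ := by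
  rw [eq_top_iff, ← Module.End.iSup_maxGenEigenspace_eq_top T]
  refine iSup_le fun μ => ?_
  by_cases hμ : T.HasEigenvalue μ
  · rcases h μ hμ with hs | ht
    · exact le_sup_of_le_left fun v hv => mem_spectralSubspace hs hv
    · exact le_sup_of_le_right fun v hv => mem_spectralSubspace ht hv
  · have : T.maxGenEigenspace μ = ⊥ := by
      by_contra hne
      exact hμ ((Module.End.hasUnifEigenvalue_iff_hasUnifEigenvalue_one
        (by simp : (0 : ℕ∞) < ⊤)).mp hne)
    rw [this]
    exact bot_le

lemma skewForm_spectralSubspace {A Q : Matrix ι ι ℂ} (hQ : Q.IsHermitian) (c : ℝ) {s t : Set ℂ}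
    (hst : ∀ μ ∈ s, ∀ ν ∈ t, star μ + ν ≠ 0) {v w : (ι → ℂ) × (ι → ℂ)}
    (hv : v ∈ spectralSubspace (hamiltonian A Q c) s)
    (hw : w ∈ spectralSubspace (hamiltonian A Q c) t) : skewForm v w = 0 := by
  refine Submodule.iSup_induction _ (motive := fun v => skewForm v w = 0) hv ?_ ?_ ?_
  · intro μ x hx
    refine Submodule.iSup_induction _ (motive := fun w => skewForm x w = 0) hw ?_ ?_ ?_
    · intro ν y hy
      obtain ⟨a, ha⟩ := (Module.End.mem_maxGenEigenspace _ _ _).mp hx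
      obtain ⟨b, hb⟩ := (Module.End.mem_maxGenEigenspace _ _ _).mp hy
      exact skewForm_eq_zero_of_pow hQ c (hst μ μ.2 ν ν.2) _ a b x y le_rfl ha hb
    · simp [skewForm]
    · intro y z hy hz
      rw [skewForm_add_right, hy, hz, add_zero]
  · simp [skewForm]
  · intro y z hy hz
    rw [skewForm_add_left, hy, hz, add_zero]

lemma mem_spectrum_of_mulVec_eq [DecidableEq ι] {A : Matrix ι ι ℂ} {μ : ℂ} {v : ι → ℂ}
    (hv : v ≠ 0) (h : A *ᵥ v = μ • v) : μ ∈ spectrum ℂ A := by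
  intro hu
  apply hv
  apply mulVec_injective_of_isUnit hu
  simp [sub_mulVec, h, Algebra.algebraMap_eq_smul_one, smul_mulVec]

lemma star_mem_spectrum_of_conjTranspose_mulVec_eq [DecidableEq ι] {A : Matrix ι ι ℂ} {μ : ℂ}
    {v : ι → ℂ} (hv : v ≠ 0) (h : Aᴴ *ᵥ v = μ • v) : star μ ∈ spectrum ℂ A := by
  have h1 := mem_spectrum_of_mulVec_eq hv h
  rwa [← star_eq_conjTranspose, spectrum.map_star, Set.mem_star] at h1

/-- The open left half-plane. -/
abbrev leftHalfPlane : Set ℂ := {z | z.re < 0}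

/-- The open right half-plane. -/
abbrev rightHalfPlane : Set ℂ := {z | 0 < z.re}

lemma skewForm_left {A Q : Matrix ι ι ℂ} (hQ : Q.IsHermitian) (c : ℝ)
    {v w : (ι → ℂ) × (ι → ℂ)} (hv : v ∈ spectralSubspace (hamiltonian A Q c) leftHalfPlane)
    (hw : w ∈ spectralSubspace (hamiltonian A Q c) leftHalfPlane) : skewForm v w = 0 := by
  refine skewForm_spectralSubspace hQ c (fun μ hμ ν hν h => ?_) hv hw
  have h1 := congrArg Complex.re h
  simp at h1 hμ hν
  linarith

lemma skewForm_right {A Q : Matrix ι ι ℂ} (hQ : Q.IsHermitian) (c : ℝ)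
    {v w : (ι → ℂ) × (ι → ℂ)} (hv : v ∈ spectralSubspace (hamiltonian A Q c) rightHalfPlane)
    (hw : w ∈ spectralSubspace (hamiltonian A Q c) rightHalfPlane) : skewForm v w = 0 := by
  refine skewForm_spectralSubspace hQ c (fun μ hμ ν hν h => ?_) hv hw
  have h1 := congrArg Complex.re h
  simp at h1 hμ hν
  linarith

lemma hamiltonian_sup_eq_top {A Q : Matrix ι ι ℂ} {c : ℝ}
    (hfreq : ∀ (ω : ℝ) v, hamiltonian A Q c v = (Complex.I * ω) • v → v = 0) :
    spectralSubspace (hamiltonian A Q c) leftHalfPlane ⊔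
      spectralSubspace (hamiltonian A Q c) rightHalfPlane = ⊤ := by
  refine spectralSubspace_sup_eq_top fun μ hμ => ?_
  rcases lt_trichotomy μ.re 0 with h | h | h
  · exact Or.inl h
  · obtain ⟨v, hv⟩ := hμ.exists_hasEigenvector
    refine absurd (hfreq μ.im v ?_) hv.2
    rw [hv.apply_eq_smul]
    congr 1
    apply Complex.ext <;> simp [h]
  · exact Or.inr h

/-- Each half-plane subspace is isotropic and together they span, so a common vector pairs to zero
with everything; the form is nondegenerate. -/
lemma disjoint_left_right {A Q : Matrix ι ι ℂ} (hQ : Q.IsHermitian) {c : ℝ}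
    (hfreq : ∀ (ω : ℝ) v, hamiltonian A Q c v = (Complex.I * ω) • v → v = 0)
    {v : (ι → ℂ) × (ι → ℂ)} (hv : v ∈ spectralSubspace (hamiltonian A Q c) leftHalfPlane)
    (hv' : v ∈ spectralSubspace (hamiltonian A Q c) rightHalfPlane) : v = 0 := by
  apply eq_zero_of_skewForm_eq_zero
  intro w
  have hw : w ∈ (⊤ : Submodule ℂ _) := Submodule.mem_top
  rw [← hamiltonian_sup_eq_top hfreq] at hw
  obtain ⟨y, hy, z, hz, rfl⟩ := Submodule.mem_sup.mp hw
  rw [skewForm_add_right, skewForm_left hQ c hv hy, skewForm_right hQ c hv' hz, add_zero]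

/-- Isotropy applied to `w` and its image gives `star w.2 ⬝ᵥ Q *ᵥ w.2 = 0`, hence `Q *ᵥ w.2 = 0`, so
the kernel `K` of the projection is invariant. There the operator acts as `-Aᴴ`, whose eigenvalues
lie in the right half-plane, so an eigenvector in `K` would lie in both spectral subspaces. -/
lemma fst_injective_on_left [DecidableEq ι] {A Q : Matrix ι ι ℂ} (hQ : Q.PosSemidef) {c : ℝ}
    (hA : ∀ z ∈ spectrum ℂ A, z.re < 0)
    (hfreq : ∀ (ω : ℝ) v, hamiltonian A Q c v = (Complex.I * ω) • v → v = 0)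
    {v : (ι → ℂ) × (ι → ℂ)} (hv : v ∈ spectralSubspace (hamiltonian A Q c) leftHalfPlane)
    (hv1 : v.1 = 0) : v = 0 := by
  set T := hamiltonian A Q c with hT
  set K : Submodule ℂ ((ι → ℂ) × (ι → ℂ)) :=
    spectralSubspace T leftHalfPlane ⊓ LinearMap.ker (LinearMap.fst ℂ _ _) with hK
  have hinv : ∀ w ∈ K, T w ∈ K := by
    rintro w ⟨hw, hw1⟩
    replace hw1 : w.1 = 0 := hw1
    refine ⟨map_mem_spectralSubspace hw, ?_⟩
    have h0 := skewForm_left hQ.isHermitian c hw (map_mem_spectralSubspace hw)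
    simp only [skewForm, hamiltonian_apply, hw1] at h0
    simp only [star_zero, zero_dotProduct, mulVec_zero, zero_add, zero_sub, neg_eq_zero] at h0
    have h1 := (hQ.dotProduct_mulVec_zero_iff _).mp h0
    change (T w).1 = 0
    simp [hT, hw1, h1]
  by_contra hne
  have hnt : Nontrivial K := ⟨⟨⟨v, hv, hv1⟩, 0, fun h => hne (congrArg Subtype.val h)⟩⟩
  obtain ⟨μ, hμ⟩ := Module.End.exists_eigenvalue (T.restrict hinv)
  obtain ⟨⟨w, hw, hw1⟩, hwe⟩ := hμ.exists_hasEigenvector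
  replace hw1 : w.1 = 0 := hw1
  have hw0 : w ≠ 0 := fun h => hwe.2 (Subtype.ext h)
  have hTw : T w = μ • w := congrArg Subtype.val hwe.apply_eq_smul
  have h2 := congrArg Prod.snd hTw
  simp only [hT, hamiltonian_apply, hw1, smul_zero, neg_zero, zero_sub, Prod.smul_snd] at h2
  have hw2 : w.2 ≠ 0 := fun h => hw0 (Prod.ext hw1 h)
  have h3 := hA _ (star_mem_spectrum_of_conjTranspose_mulVec_eq (μ := -μ) hw2
    (by rw [neg_smul, ← h2, neg_neg]))
  refine hw0 (disjoint_left_right hQ.isHermitian hfreq hw (mem_spectralSubspace (μ := μ) ?_ ?_))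
  · simpa using h3
  · exact Module.End.eigenspace_le_maxGenEigenspace (Module.End.mem_eigenspace_iff.mpr hTw)

/-- Isotropy applied to `v` and its image reads `c * (star v.1 ⬝ᵥ v.1) = 0`. -/
lemma snd_injective_on_right {A Q : Matrix ι ι ℂ} (hQ : Q.IsHermitian) {c : ℝ} (hc : 0 < c)
    {v : (ι → ℂ) × (ι → ℂ)} (hv : v ∈ spectralSubspace (hamiltonian A Q c) rightHalfPlane)
    (hv2 : v.2 = 0) : v = 0 := by
  have h0 := skewForm_right hQ c hv (map_mem_spectralSubspace hv)
  simp only [skewForm, hamiltonian_apply, hv2] at h0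
  simp only [mulVec_zero, sub_zero, star_zero, zero_dotProduct, dotProduct_neg, dotProduct_smul,
    neg_eq_zero, smul_eq_mul, mul_eq_zero, Complex.ofReal_eq_zero, hc.ne', false_or,
    dotProduct_star_self_eq_zero] at h0
  exact Prod.ext h0 hv2

/-- The stable subspace of the Hamiltonian operator is the graph of a matrix. -/
lemma exists_graph [DecidableEq ι] {A Q : Matrix ι ι ℂ} (hQ : Q.PosSemidef) {c : ℝ} (hc : 0 < c)
    (hA : ∀ z ∈ spectrum ℂ A, z.re < 0)
    (hfreq : ∀ (ω : ℝ) v, hamiltonian A Q c v = (Complex.I * ω) • v → v = 0) :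
    ∃ P : Matrix ι ι ℂ, ∀ v, v ∈ spectralSubspace (hamiltonian A Q c) leftHalfPlane ↔
      v.2 = P *ᵥ v.1 := by
  set E := spectralSubspace (hamiltonian A Q c) leftHalfPlane with hE
  set E' := spectralSubspace (hamiltonian A Q c) rightHalfPlane with hE'
  have i1 : Function.Injective ((LinearMap.fst ℂ (ι → ℂ) (ι → ℂ)).domRestrict E) := by
    rw [← LinearMap.ker_eq_bot, LinearMap.ker_eq_bot']
    rintro ⟨v, hv⟩ h
    exact Subtype.ext (fst_injective_on_left hQ hA hfreq hv h)
  have i2 : Function.Injective ((LinearMap.snd ℂ (ι → ℂ) (ι → ℂ)).domRestrict E') := by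
    rw [← LinearMap.ker_eq_bot, LinearMap.ker_eq_bot']
    rintro ⟨v, hv⟩ h
    exact Subtype.ext (snd_injective_on_right hQ.isHermitian hc hv h)
  -- Both subspaces have dimension at most that of `ι → ℂ` and their sum is the doubled space, so
  -- both bounds are equalities and the first projection is bijective on `E`.
  have d1 := LinearMap.finrank_le_finrank_of_injective i1
  have d2 := LinearMap.finrank_le_finrank_of_injective i2
  have d3 := Submodule.finrank_add_le_finrank_add_finrank E E'
  rw [hamiltonian_sup_eq_top hfreq, finrank_top, Module.finrank_prod] at d3
  have d4 : finrank ℂ E = finrank ℂ (ι → ℂ) := by omega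
  have s1 := (LinearMap.injective_iff_surjective_of_finrank_eq_finrank d4).mp i1
  let e := LinearEquiv.ofBijective _ ⟨i1, s1⟩
  have he : ∀ w : E, e w = w.1.1 := fun w => rfl
  refine ⟨LinearMap.toMatrix' (LinearMap.snd ℂ _ _ ∘ₗ E.subtype ∘ₗ e.symm.toLinearMap),
    fun v => ?_⟩
  rw [← Matrix.toLin'_apply, Matrix.toLin'_toMatrix']
  constructor
  · intro hv
    have h1 : e.symm v.1 = ⟨v, hv⟩ := by
      rw [LinearEquiv.symm_apply_eq, he]
    simp [h1]
  · intro hv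
    have h1 : (e.symm v.1).1.1 = v.1 := by rw [← he, LinearEquiv.apply_symm_apply]
    have h2 : v = (e.symm v.1).1 := Prod.ext h1.symm hv
    rw [h2]
    exact (e.symm v.1).2

lemma star_mulVec_map_star (A : Matrix ι ι ℂ) (x : ι → ℂ) :
    star (A *ᵥ x) = A.map star *ᵥ star x := by
  ext i
  simp [mulVec, dotProduct]

/-- For real data conjugation commutes with the operator, hence maps the generalized eigenspace of
`μ` into that of `star μ`, which has the same real part. -/
lemma star_mem_left {A Q : Matrix ι ι ℂ} {c : ℝ} (hA : A.map star = A) (hQ : Q.map star = Q)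
    {v : (ι → ℂ) × (ι → ℂ)} (hv : v ∈ spectralSubspace (hamiltonian A Q c) leftHalfPlane) :
    star v ∈ spectralSubspace (hamiltonian A Q c) leftHalfPlane := by
  have hAH : Aᴴ.map star = Aᴴ := by
    conv_rhs => rw [← hA]
    rfl
  have hstar : ∀ w, hamiltonian A Q c (star w) = star (hamiltonian A Q c w) := by
    intro w
    apply Prod.ext
    · simp only [hamiltonian_apply, Prod.fst_star, Prod.snd_star, star_add,
        star_mulVec_map_star, hA, hQ]
    · simp only [hamiltonian_apply, Prod.fst_star, Prod.snd_star, star_sub, star_neg, star_smul,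
        star_mulVec_map_star, hAH]
      simp
  have hpow : ∀ (μ : ℂ) (j : ℕ) w, ((hamiltonian A Q c - star μ • 1) ^ j) (star w) =
      star (((hamiltonian A Q c - μ • 1) ^ j) w) := by
    intro μ j
    induction j with
    | zero => simp
    | succ j ih =>
      intro w
      rw [pow_succ, pow_succ, Module.End.mul_apply, Module.End.mul_apply, ← ih]
      congr 1
      rw [LinearMap.sub_apply, LinearMap.sub_apply, hstar, star_sub, LinearMap.smul_apply,
        LinearMap.smul_apply, Module.End.one_apply, Module.End.one_apply, star_smul]
  refine Submodule.iSup_induction _ (motive := fun v => star v ∈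
    spectralSubspace (hamiltonian A Q c) leftHalfPlane) hv ?_ ?_ ?_
  · intro μ x hx
    obtain ⟨j, hj⟩ := (Module.End.mem_maxGenEigenspace _ _ _).mp hx
    refine mem_spectralSubspace (μ := star μ.1) (by simpa using (show μ.1.re < 0 from μ.2))
      ((Module.End.mem_maxGenEigenspace _ _ _).mpr ⟨j, ?_⟩)
    rw [hpow, hj, star_zero]
  · simp
  · intro x y hx hy
    rw [star_add]
    exact add_mem hx hy

/-- If the Hamiltonian operator has no imaginary eigenvalues, the Riccati equation has a Hermitian
solution, real for real data. -/
theorem exists_isHermitian_riccati [DecidableEq ι] {A Q : Matrix ι ι ℂ} (hQ : Q.PosSemidef) {c : ℝ}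
    (hc : 0 < c) (hA : ∀ z ∈ spectrum ℂ A, z.re < 0) (hAr : A.map star = A) (hQr : Q.map star = Q)
    (hfreq : ∀ (ω : ℝ) v, hamiltonian A Q c v = (Complex.I * ω) • v → v = 0) :
    ∃ P : Matrix ι ι ℂ, P.IsHermitian ∧ P.map star = P ∧
      P * A + Aᴴ * P + (c : ℂ) • (1 : Matrix ι ι ℂ) + P * Q * P = 0 := by
  obtain ⟨P, hP⟩ := exists_graph hQ hc hA hfreq
  have hmem : ∀ x, ((x, P *ᵥ x) : (ι → ℂ) × (ι → ℂ)) ∈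
      spectralSubspace (hamiltonian A Q c) leftHalfPlane := fun x => (hP _).mpr rfl
  refine ⟨P, ?_, ?_, ?_⟩
  -- Isotropy of the graph makes `P` Hermitian, its stability under conjugation makes `P` real, and
  -- its invariance under the Hamiltonian is the Riccati equation.
  · apply Matrix.mulVec_injective
    funext x
    apply dotProduct_eq
    intro y
    have h := skewForm_left hQ.isHermitian c (hmem (star y)) (hmem x)
    simp only [skewForm, star_star] at h
    rw [sub_eq_zero, star_mulVec, ← dotProduct_mulVec, star_star] at h
    rw [dotProduct_comm _ y, dotProduct_comm _ y, h]
  · apply Matrix.mulVec_injective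
    funext x
    have h := (hP _).mp (star_mem_left hAr hQr (hmem (star x)))
    simp only [Prod.snd_star, Prod.fst_star, star_star] at h
    rw [← h, star_mulVec_map_star, star_star]
  · apply Matrix.mulVec_injective
    funext x
    have h := (hP _).mp (map_mem_spectralSubspace (hmem x))
    simp only [hamiltonian_apply, mulVec_add, mulVec_mulVec] at h
    simp only [add_mulVec, smul_mulVec, one_mulVec, zero_mulVec, Matrix.mul_assoc] at h ⊢
    have h' : (P * A) *ᵥ x = -((c : ℂ) • x) - (Aᴴ * P) *ᵥ x - (P * (Q * P)) *ᵥ x := by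
      rw [h]; abel
    rw [h']
    abel

end Hamiltonian

/-! ### Lyapunov's theorem through the Cayley transform -/

section Lyapunov

variable {ι : Type} [Fintype ι] [DecidableEq ι]

/-- Gelfand's formula: the spectral radius is below some `r < 1`, so `‖a ^ n‖ ≤ r ^ n` eventually.
-/
lemma tendsto_pow_zero_of_spectrum {𝔸 : Type*} [NormedRing 𝔸] [NormedAlgebra ℂ 𝔸] [CompleteSpace 𝔸]
    {a : 𝔸} (h : ∀ z ∈ spectrum ℂ a, ‖z‖ < 1) : Tendsto (fun n : ℕ => a ^ n) atTop (𝓝 0) := by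
  have h1 : spectralRadius ℂ a < 1 := by
    nontriviality 𝔸
    exact_mod_cast spectrum.spectralRadius_lt_of_forall_lt (r := 1) a fun z hz => by
      exact_mod_cast h z hz
  obtain ⟨r, hr1, hr2⟩ := ENNReal.lt_iff_exists_nnreal_btwn.mp h1
  have hr3 : r < 1 := by exact_mod_cast hr2
  have h2 := (spectrum.pow_nnnorm_pow_one_div_tendsto_nhds_spectralRadius a).eventually_lt_const hr1
  apply squeeze_zero_norm' (a := fun n : ℕ => (r : ℝ) ^ n)
  · filter_upwards [h2, eventually_gt_atTop 0] with n hn hn0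
    have h3 : ‖a ^ n‖₊ ^ (1 / n : ℝ) < r := by
      rw [← ENNReal.coe_lt_coe, ENNReal.coe_rpow_of_nonneg _ (by positivity)]
      exact hn
    have h4 := (NNReal.rpow_lt_rpow_iff (z := n) (by positivity)).mpr h3
    rw [← NNReal.rpow_mul, one_div_mul_cancel (by positivity), NNReal.rpow_one,
      NNReal.rpow_natCast] at h4
    exact_mod_cast h4.le
  · exact tendsto_pow_atTop_nhds_zero_of_lt_one r.2 hr3

lemma isUnit_sub_of_hurwitz {A : Matrix ι ι ℂ} (hA : ∀ z ∈ spectrum ℂ A, z.re < 0) {s : ℂ}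
    (hs : 0 ≤ s.re) : IsUnit (s • (1 : Matrix ι ι ℂ) - A) := by
  by_contra h
  exact absurd (hA s (by
    rwa [spectrum.mem_iff, Algebra.algebraMap_eq_smul_one])) (not_lt.mpr hs)

/-- The point `z` pulls back to the eigenvalue `(z - 1) / (z + 1)` of `A`, whose real part is
negative exactly when `‖z‖ < 1`. The value `z = -1` is excluded because the pencil is then `-2`
times the identity. -/
lemma norm_lt_one_of_mem_spectrum_cayley {A : Matrix ι ι ℂ} (hA : ∀ z ∈ spectrum ℂ A, z.re < 0)
    {z : ℂ} (hz : z ∈ spectrum ℂ ((1 + A) * (1 - A)⁻¹)) : ‖z‖ < 1 := by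
  have hu : IsUnit (1 - A) := by simpa using isUnit_sub_of_hurwitz hA (s := 1) (by simp)
  have hdet := (Matrix.isUnit_iff_isUnit_det _).mp hu
  have hmul : (z • (1 : Matrix ι ι ℂ) - (1 + A) * (1 - A)⁻¹) * (1 - A) =
      (z - 1) • 1 - (z + 1) • A := by
    rw [sub_mul, Matrix.mul_assoc, Matrix.nonsing_inv_mul _ hdet]
    simp [mul_sub, sub_smul, add_smul]
    abel
  rw [spectrum.mem_iff, Algebra.algebraMap_eq_smul_one] at hz
  have hnu : ¬ IsUnit ((z - 1) • (1 : Matrix ι ι ℂ) - (z + 1) • A) := by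
    rw [← hmul]
    intro h
    apply hz
    have := h.mul (Matrix.isUnit_nonsing_inv_iff.mpr hu)
    rwa [Matrix.mul_assoc, Matrix.mul_nonsing_inv _ hdet, Matrix.mul_one] at this
  have hz1 : z + 1 ≠ 0 := by
    intro h
    rw [h, zero_smul, sub_zero] at hnu
    have h2 : z - 1 ≠ 0 := by
      rw [eq_neg_of_add_eq_zero_left h]; norm_num
    exact hnu ((isUnit_one).smul (Units.mk0 _ h2))
  have hmem : (z - 1) / (z + 1) ∈ spectrum ℂ A := by
    rw [spectrum.mem_iff, Algebra.algebraMap_eq_smul_one]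
    intro h
    apply hnu
    have := h.smul (Units.mk0 _ hz1)
    rw [Units.smul_mk0, smul_sub, smul_smul, mul_div_cancel₀ _ hz1] at this
    exact this
  have hre := hA _ hmem
  rw [Complex.div_re, ← add_div, div_neg_iff] at hre
  have hn : 0 < Complex.normSq (z + 1) := Complex.normSq_pos.mpr hz1
  have h3 : (z - 1).re * (z + 1).re + (z - 1).im * (z + 1).im < 0 := by
    rcases hre with h | h
    · linarith [h.2]
    · exact h.1
  simp at h3
  rw [← sq_lt_one_iff₀ (norm_nonneg z), Complex.sq_norm, Complex.normSq_apply]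
  linarith

/-- Lyapunov's theorem. -/
theorem posDef_of_lyapunov {A P : Matrix ι ι ℂ} (hA : ∀ z ∈ spectrum ℂ A, z.re < 0)
    (hP : P.IsHermitian) (hW : (-(P * A + Aᴴ * P)).PosDef) : P.PosDef := by
  have hu : IsUnit (1 - A) := by simpa using isUnit_sub_of_hurwitz hA (s := 1) (by simp)
  have hdet := (Matrix.isUnit_iff_isUnit_det _).mp hu
  obtain ⟨C, hC⟩ : ∃ C, C = (1 + A) * (1 - A)⁻¹ := ⟨_, rfl⟩
  -- Congruence by `1 - A` turns the discrete Stein expression into twice the Lyapunov expression.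
  have hdiff : (P - Cᴴ * P * C).PosDef := by
    have h1 : (1 - A)ᴴ * (P - Cᴴ * P * C) * (1 - A) = (2 : ℝ) • (-(P * A + Aᴴ * P)) := by
      have h2 : C * (1 - A) = 1 + A := by
        rw [hC, Matrix.mul_assoc, Matrix.nonsing_inv_mul _ hdet, Matrix.mul_one]
      have h3 : (1 - A)ᴴ * Cᴴ = (1 + A)ᴴ := by rw [← conjTranspose_mul, h2]
      have h4 : (1 - A)ᴴ * (P - Cᴴ * P * C) * (1 - A) =
          (1 - A)ᴴ * P * (1 - A) - ((1 - A)ᴴ * Cᴴ) * P * (C * (1 - A)) := by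
        noncomm_ring
      rw [h4, h3, h2, two_smul]
      simp only [conjTranspose_add, conjTranspose_sub, conjTranspose_one]
      noncomm_ring
    have h5 : ((1 - A)ᴴ * (P - Cᴴ * P * C) * (1 - A)).PosDef := by
      rw [h1, two_smul]; exact hW.add hW
    rw [← star_eq_conjTranspose] at h5
    exact (Matrix.IsUnit.posDef_star_left_conjugate_iff hu).mp h5
  have hdec : ∀ x : ι → ℂ, star (C *ᵥ x) ⬝ᵥ (P *ᵥ (C *ᵥ x)) ≤ star x ⬝ᵥ (P *ᵥ x) := by
    intro x
    have h := hdiff.posSemidef.dotProduct_mulVec_nonneg x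
    rw [sub_mulVec, dotProduct_sub, sub_nonneg] at h
    rw [star_mulVec, ← dotProduct_mulVec, mulVec_mulVec, mulVec_mulVec]
    exact h
  have hpow : ∀ (x : ι → ℂ) (j : ℕ),
      star ((C ^ j) *ᵥ x) ⬝ᵥ (P *ᵥ ((C ^ j) *ᵥ x)) ≤ star x ⬝ᵥ (P *ᵥ x) := by
    intro x j
    induction j with
    | zero => simp
    | succ j ih =>
      refine le_trans ?_ ih
      rw [pow_succ', ← mulVec_mulVec]
      exact hdec _
  -- The quadratic form does not increase along `C ^ j *ᵥ x`, which tends to zero. Strictness comes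
  -- afterwards from one application of `hdiff`.
  have hnn : ∀ x : ι → ℂ, 0 ≤ star x ⬝ᵥ (P *ᵥ x) := by
    intro x
    have hlim : Tendsto (fun j : ℕ => star ((C ^ j) *ᵥ x) ⬝ᵥ (P *ᵥ ((C ^ j) *ᵥ x))) atTop
        (𝓝 (star ((0 : Matrix ι ι ℂ) *ᵥ x) ⬝ᵥ (P *ᵥ ((0 : Matrix ι ι ℂ) *ᵥ x)))) := by
      have hcont : Continuous fun M : Matrix ι ι ℂ => star (M *ᵥ x) ⬝ᵥ (P *ᵥ (M *ᵥ x)) := by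
        fun_prop
      exact (hcont.tendsto 0).comp
        (tendsto_pow_zero_of_spectrum fun z hz => norm_lt_one_of_mem_spectrum_cayley hA (hC ▸ hz))
    simp only [zero_mulVec, star_zero, mulVec_zero, dotProduct_zero] at hlim
    exact le_of_tendsto hlim (Eventually.of_forall (hpow x))
  refine PosDef.of_dotProduct_mulVec_pos hP fun x hx => ?_
  have h := hdiff.dotProduct_mulVec_pos hx
  rw [sub_mulVec, dotProduct_sub, sub_pos] at h
  refine lt_of_le_of_lt (hnn (C *ᵥ x)) ?_
  rw [star_mulVec, ← dotProduct_mulVec, mulVec_mulVec, mulVec_mulVec]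
  exact h

end Lyapunov

/-! ### Small gain and positive definite real Riccati solutions -/

section RealRiccati

variable {ι : Type} [Fintype ι] [DecidableEq ι]

lemma eq_zero_of_mulVec_eq_self {M : Matrix ι ι ℂ} (hM : ‖M‖ < 1) {x : ι → ℂ} (h : M *ᵥ x = x) :
    x = 0 := by
  have hu : IsUnit (1 - M) := isUnit_one_sub_of_norm_lt_one hM
  apply mulVec_injective_of_isUnit hu
  simp [sub_mulVec, h]

lemma IsHurwitz.isUnit_sub {A : Matrix ι ι ℝ} (hA : IsHurwitz A) {s : ℂ} (hs : 0 ≤ s.re) :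
    IsUnit (s • (1 : Matrix ι ι ℂ) - toC A) :=
  isUnit_sub_of_hurwitz hA hs

lemma conjTranspose_toC {a b : Type} (M : Matrix a b ℝ) : (toC M)ᴴ = toC Mᵀ := by
  ext i j; simp

lemma toC_mul {a b c : Type} [Fintype b] (M : Matrix a b ℝ) (N : Matrix b c ℝ) :
    toC (M * N) = toC M * toC N :=
  Matrix.map_mul (f := Complex.ofRealHom)

lemma toC_injective {a b : Type} : Function.Injective (toC : Matrix a b ℝ → Matrix a b ℂ) :=
  fun _ _ h => Matrix.map_injective Complex.ofReal_injective h

/-- Small gain excludes imaginary eigenvalues of the Hamiltonian operator. -/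
lemma hamiltonian_eq_zero_of_gain {A Q : Matrix ι ι ℝ} (hA : IsHurwitz A) {c : ℝ} (hc : 0 < c)
    (hgain : ∀ ω : ℝ, c * specNorm (resolventMat A (Complex.I * ω) * toC Q *
      (resolventMat A (Complex.I * ω))ᴴ) < 1) (ω : ℝ) (v : (ι → ℂ) × (ι → ℂ))
    (hv : hamiltonian (toC A) (toC Q) c v = (Complex.I * ω) • v) : v = 0 := by
  set s : ℂ := Complex.I * ω with hs
  have hu := hA.isUnit_sub (s := s) (by simp [hs])
  have hdet := (Matrix.isUnit_iff_isUnit_det _).mp hu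
  set U := s • (1 : Matrix ι ι ℂ) - toC A with hU
  have hR : resolventMat A s = U⁻¹ := rfl
  have h1 : U *ᵥ v.1 = toC Q *ᵥ v.2 := by
    have := congrArg Prod.fst hv
    simp only [hamiltonian_apply, Prod.smul_fst] at this
    rw [hU, sub_mulVec, smul_mulVec, one_mulVec, ← this, add_sub_cancel_left]
  have h2 : Uᴴ *ᵥ v.2 = (c : ℂ) • v.1 := by
    have := congrArg Prod.snd hv
    simp only [hamiltonian_apply, Prod.smul_snd] at this
    have hss : star s = -s := by simp [hs]
    rw [hU, conjTranspose_sub, conjTranspose_smul, conjTranspose_one, hss, sub_mulVec, smul_mulVec,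
      one_mulVec, neg_smul, ← this]
    abel
  have h3 : v.2 = (c : ℂ) • (Uᴴ)⁻¹ *ᵥ v.1 := by
    rw [← mulVec_smul, ← h2, mulVec_mulVec, Matrix.nonsing_inv_mul _
      (by rw [det_conjTranspose]; exact hdet.star), one_mulVec]
  -- Eliminating `v.2` makes `v.1` a fixed vector of a matrix of norm less than one.
  have h4 : v.1 = ((c : ℂ) • (U⁻¹ * toC Q * (U⁻¹)ᴴ)) *ᵥ v.1 := by
    rw [conjTranspose_nonsing_inv, smul_mulVec, ← mulVec_mulVec, ← mulVec_smul, ← h3,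
      ← mulVec_mulVec, ← h1, mulVec_mulVec, Matrix.nonsing_inv_mul _ hdet, one_mulVec]
  have h5 : v.1 = 0 := by
    refine eq_zero_of_mulVec_eq_self ?_ h4.symm
    rw [norm_smul, Complex.norm_real, Real.norm_of_nonneg hc.le]
    exact hgain ω
  refine Prod.ext h5 ?_
  rw [h3, h5]
  simp

/-- Under the strict small gain condition, the Riccati equation has a positive definite solution. -/
theorem exists_posDef_riccati {A Q : Matrix ι ι ℝ} (hA : IsHurwitz A) (hQ : (toC Q).PosSemidef)
    {c : ℝ} (hc : 0 < c)
    (hgain : ∀ ω : ℝ, c * specNorm (resolventMat A (Complex.I * ω) * toC Q *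
      (resolventMat A (Complex.I * ω))ᴴ) < 1) :
    ∃ X : Matrix ι ι ℝ, X.PosDef ∧ X * A + Aᵀ * X + c • (1 : Matrix ι ι ℝ) + X * Q * X = 0 := by
  have hreal : ∀ M : Matrix ι ι ℝ, (toC M).map star = toC M := by
    intro M; ext i j; simp
  obtain ⟨P, hPH, hPr, hP⟩ := exists_isHermitian_riccati hQ hc hA (hreal A) (hreal Q)
    (hamiltonian_eq_zero_of_gain hA hc hgain)
  have hPD : P.PosDef := by
    refine posDef_of_lyapunov hA hPH ?_
    -- The Riccati equation is itself a Lyapunov equation for `P`, with right-hand side definite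
    -- because `c > 0`.
    have h1 : -(P * toC A + (toC A)ᴴ * P) = (c : ℂ) • (1 : Matrix ι ι ℂ) + P * toC Q * P := by
      rw [neg_eq_iff_add_eq_zero, ← hP]; abel
    rw [h1]
    refine PosDef.add_posSemidef (PosDef.one.smul (by exact_mod_cast hc)) ?_
    have := hQ.conjTranspose_mul_mul_same P
    rwa [hPH.eq] at this
  set X : Matrix ι ι ℝ := P.map Complex.re with hX
  have hXP : toC X = P := by
    ext i j
    have h := congrFun (congrFun hPr i) j
    simpa [hX] using Complex.conj_eq_iff_re.mp h
  refine ⟨X, PosDef.of_dotProduct_mulVec_pos ?_ fun x hx => ?_, ?_⟩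
  · apply toC_injective
    rw [hXP, ← hPH.eq, ← hXP, conjTranspose_toC]
    rfl
  · have hx' : (fun i => (x i : ℂ)) ≠ 0 := fun h => hx (funext fun i => by
      simpa using congrFun h i)
    have h := hPD.dotProduct_mulVec_pos hx'
    rw [← hXP] at h
    have h2 : star (fun i => (x i : ℂ)) ⬝ᵥ (toC X *ᵥ fun i => (x i : ℂ)) =
        ((star x ⬝ᵥ (X *ᵥ x) : ℝ) : ℂ) := by
      simp [dotProduct, mulVec]
    rw [h2] at h
    exact_mod_cast h
  · apply toC_injective
    have h3 : toC (X * A + Aᵀ * X + c • (1 : Matrix ι ι ℝ) + X * Q * X) =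
        toC X * toC A + toC Aᵀ * toC X + (c : ℂ) • (1 : Matrix ι ι ℂ) + toC X * toC Q * toC X := by
      rw [← toC_mul, ← toC_mul, ← toC_mul, ← toC_mul]
      ext i j
      by_cases hij : i = j <;> simp [hij]
    rw [h3, hXP, ← conjTranspose_toC, hP]
    ext; simp

end RealRiccati

/-! ### Transfer functions on the imaginary axis -/

section TransferFunctions

variable {ι : Type} [Fintype ι] [DecidableEq ι]

lemma resolventMat_eq_resolvent {A : Matrix ι ι ℝ} (s : ℂ) :
    resolventMat A s = resolvent (toC A) s := by
  rw [resolventMat, resolvent, Algebra.algebraMap_eq_smul_one, nonsing_inv_eq_ringInverse]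

/-- The resolvent of a Hurwitz matrix is bounded on the imaginary axis. -/
lemma exists_norm_resolventMat_le {A : Matrix ι ι ℝ} (hA : IsHurwitz A) :
    ∃ K, ∀ ω : ℝ, ‖resolventMat A (Complex.I * ω)‖ ≤ K := by
  have hcont : Continuous fun ω : ℝ => ‖resolvent (toC A) (Complex.I * ω)‖ := by
    refine continuous_iff_continuousAt.mpr fun ω => ContinuousAt.norm ?_
    have h1 : ContinuousAt (resolvent (toC A)) (Complex.I * ω) := by
      refine (spectrum.hasDerivAt_resolvent_const_left ?_).continuousAt
      rw [spectrum.mem_resolventSet_iff, Algebra.algebraMap_eq_smul_one]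
      exact hA.isUnit_sub (by simp)
    exact ContinuousAt.comp (f := fun ω : ℝ => Complex.I * (ω : ℂ)) h1 (by fun_prop)
  -- Decay at infinity bounds the resolvent by one off a compact set, where continuity takes over.
  have htend : Tendsto (fun ω : ℝ => ‖resolvent (toC A) (Complex.I * ω)‖)
      (cocompact ℝ) (𝓝 0) := by
    rw [← norm_zero (E := Matrix ι ι ℂ)]
    refine ((spectrum.resolvent_tendsto_cobounded (𝕜 := ℂ) (toC A)).comp ?_).norm
    rw [← tendsto_norm_atTop_iff_cobounded]
    have : (fun ω : ℝ => ‖Complex.I * (ω : ℂ)‖) = fun ω => ‖ω‖ := by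
      ext ω; simp
    rw [this]
    exact tendsto_norm_cocompact_atTop
  obtain ⟨t, ht, hsub⟩ := mem_cocompact.mp (htend.eventually_lt_const one_pos)
  obtain ⟨r, hr⟩ := ht.bddAbove_image hcont.continuousOn
  refine ⟨max r 1, fun ω => ?_⟩
  rw [resolventMat_eq_resolvent]
  by_cases hω : ω ∈ t
  · exact le_max_of_le_left (hr ⟨ω, hω, rfl⟩)
  · exact le_max_of_le_right (le_of_lt (hsub hω))

/-- A real supremum over an unbounded set is zero by convention; the uniform bound `K` makes it a
genuine upper bound. -/
lemma specNorm_le_hinfNorm {a b : Type} [Fintype a] [Fintype b] [DecidableEq b]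
    {T : ℂ → Matrix a b ℂ} {K : ℝ} (hT : ∀ ω : ℝ, ‖T (Complex.I * ω)‖ ≤ K) (ω : ℝ) :
    ‖T (Complex.I * ω)‖ ≤ hinfNorm T :=
  le_ciSup (f := fun ω : ℝ => specNorm (T (Complex.I * ω))) ⟨K, by rintro _ ⟨ω, rfl⟩; exact hT ω⟩ ω

lemma norm_resolventMat_mul_le {b : Type} [Fintype b] [DecidableEq b] {A : Matrix ι ι ℝ}
    (hA : IsHurwitz A) (N : Matrix ι b ℝ) (ω : ℝ) :
    ‖resolventMat A (Complex.I * ω) * toC N‖ ≤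
      hinfNorm fun s => resolventMat A s * toC N := by
  obtain ⟨K, hK⟩ := exists_norm_resolventMat_le hA
  refine specNorm_le_hinfNorm (T := fun s => resolventMat A s * toC N) (K := K * ‖toC N‖)
    (fun ω => ?_) ω
  exact (l2_opNorm_mul _ _).trans (mul_le_mul_of_nonneg_right (hK ω) (norm_nonneg _))

lemma norm_transferFn_le {u y : Type} [Fintype u] [DecidableEq u] [Fintype y]
    {A : Matrix ι ι ℝ} (hA : IsHurwitz A) (B : Matrix ι u ℝ) (C : Matrix y ι ℝ)
    (D : Matrix y u ℝ) (ω : ℝ) :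
    ‖transferFn A B C D (Complex.I * ω)‖ ≤ hinfNorm (transferFn A B C D) := by
  obtain ⟨K, hK⟩ := exists_norm_resolventMat_le hA
  refine specNorm_le_hinfNorm (K := ‖toC C‖ * K * ‖toC B‖ + ‖toC D‖) (fun ω => ?_) ω
  refine (norm_add_le _ _).trans (add_le_add_left ?_ _)
  refine (l2_opNorm_mul _ _).trans (mul_le_mul_of_nonneg_right ?_ (norm_nonneg _))
  exact (l2_opNorm_mul _ _).trans (mul_le_mul_of_nonneg_left (hK ω) (norm_nonneg _))

lemma hinfNorm_nonneg {a b : Type} [Fintype a] [Fintype b] [DecidableEq b]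
    (T : ℂ → Matrix a b ℂ) : 0 ≤ hinfNorm T :=
  Real.iSup_nonneg fun _ => norm_nonneg _

/-- The resolvent is invertible at frequency zero, so vanishing there already forces `N = 0`. This
makes the multipliers attached to nonzero blocks invertible. -/
lemma hinfNorm_resolventMat_mul_eq_zero_iff {b : Type} [Fintype b] [DecidableEq b]
    {A : Matrix ι ι ℝ} (hA : IsHurwitz A) (N : Matrix ι b ℝ) :
    (hinfNorm fun s => resolventMat A s * toC N) = 0 ↔ N = 0 := by
  constructor
  · intro h
    have h1 := norm_resolventMat_mul_le hA N 0
    rw [h, norm_le_zero_iff] at h1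
    have hdet := (Matrix.isUnit_iff_isUnit_det _).mp
      (hA.isUnit_sub (s := Complex.I * (0 : ℝ)) (by simp))
    have h2 := congrArg ((((Complex.I * (0 : ℝ) : ℂ)) • (1 : Matrix ι ι ℂ) - toC A) * ·) h1
    simp only [resolventMat] at h2
    rw [← Matrix.mul_assoc, Matrix.mul_nonsing_inv _ hdet, Matrix.one_mul, Matrix.mul_zero] at h2
    apply toC_injective
    rw [h2]
    ext; simp
  · rintro rfl
    have : toC (0 : Matrix ι b ℝ) = 0 := by ext; simp
    simp [hinfNorm, this, specNorm]

end TransferFunctions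

/-! ### Metzler matrices and the linear program of a positive system -/

section PositiveSystems

variable {ι : Type} [Fintype ι] [DecidableEq ι]

lemma pow_entry_nonneg {N : Matrix ι ι ℝ} (hN : ∀ i j, 0 ≤ N i j) (r : ℕ) :
    ∀ i j, 0 ≤ (N ^ r) i j := by
  induction r with
  | zero =>
    intro i j
    rw [pow_zero, Matrix.one_apply]
    split_ifs <;> norm_num
  | succ r ih =>
    intro i j
    rw [pow_succ, Matrix.mul_apply]
    exact Finset.sum_nonneg fun l _ => mul_nonneg (ih i l) (hN l j)

lemma mul_entry_nonneg {a b c : Type} [Fintype b] {M : Matrix a b ℝ} {N : Matrix b c ℝ}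
    (hM : ∀ i j, 0 ≤ M i j) (hN : ∀ i j, 0 ≤ N i j) (i : a) (j : c) : 0 ≤ (M * N) i j := by
  rw [Matrix.mul_apply]
  exact Finset.sum_nonneg fun l _ => mul_nonneg (hM i l) (hN l j)

lemma mulVec_nonneg_of_nonneg {a b : Type} [Fintype b] {M : Matrix a b ℝ} {v : b → ℝ}
    (hM : ∀ i j, 0 ≤ M i j) (hv : ∀ j, 0 ≤ v j) (i : a) : 0 ≤ (M *ᵥ v) i :=
  Finset.sum_nonneg fun l _ => mul_nonneg (hM i l) (hv l)

/-- Entrywise nonnegativity of the Neumann series. -/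
lemma inv_one_sub_entry_nonneg {N : Matrix ι ι ℝ} (hN : ∀ i j, 0 ≤ N i j) (h : ‖N‖ < 1) (i j : ι) :
    0 ≤ (1 - N)⁻¹ i j := by
  have hinv : (1 - N)⁻¹ = ∑' r : ℕ, N ^ r :=
    Matrix.inv_eq_left_inv (geom_series_mul_neg N h)
  have ht := (summable_geometric_of_norm_lt_one h).hasSum.tendsto_sum_nat
  rw [← hinv] at ht
  have hcont : Continuous fun M : Matrix ι ι ℝ => M i j := by fun_prop
  refine ge_of_tendsto ((hcont.tendsto _).comp ht) (Eventually.of_forall fun r => ?_)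
  simp only [Function.comp_apply, Matrix.sum_apply]
  exact Finset.sum_nonneg fun l _ => pow_entry_nonneg hN l i j

lemma IsHurwitz.isUnit_real_sub {F : Matrix ι ι ℝ} (hF : IsHurwitz F) {t : ℝ} (ht : 0 ≤ t) :
    IsUnit (t • (1 : Matrix ι ι ℝ) - F) := by
  have h := hF.isUnit_sub (s := (t : ℂ)) (by simpa using ht)
  have h1 : (t : ℂ) • (1 : Matrix ι ι ℂ) - toC F = toC (t • (1 : Matrix ι ι ℝ) - F) := by
    ext i j
    by_cases hij : i = j <;> simp [hij]
  rw [h1, Matrix.isUnit_iff_isUnit_det] at h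
  rw [Matrix.isUnit_iff_isUnit_det, isUnit_iff_ne_zero]
  intro h0
  have h2 : (toC (t • (1 : Matrix ι ι ℝ) - F)).det = ((t • (1 : Matrix ι ι ℝ) - F).det : ℂ) :=
    (RingHom.map_det Complex.ofRealHom _).symm
  rw [h2, h0] at h
  simp at h

lemma continuousOn_inv_smul_one_sub {F : Matrix ι ι ℝ} (hF : IsHurwitz F) :
    ContinuousOn (fun t : ℝ => (t • (1 : Matrix ι ι ℝ) - F)⁻¹) (Set.Ici 0) := by
  intro t ht
  apply ContinuousAt.continuousWithinAt
  obtain ⟨u, hu⟩ := hF.isUnit_real_sub ht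
  have h1 : ContinuousAt (Ring.inverse : Matrix ι ι ℝ → _) (t • (1 : Matrix ι ι ℝ) - F) := by
    rw [← hu]; exact NormedRing.inverse_continuousAt u
  simp only [nonsing_inv_eq_ringInverse]
  exact ContinuousAt.comp (f := fun t : ℝ => t • (1 : Matrix ι ι ℝ) - F) h1 (by fun_prop)

/-- The resolvent of a Hurwitz Metzler matrix is entrywise nonnegative on the nonnegative reals. -/
lemma resolvent_entry_nonneg {F : Matrix ι ι ℝ} (hF : IsHurwitz F) {α : ℝ}
    (hN : ∀ i j, 0 ≤ (F + α • (1 : Matrix ι ι ℝ)) i j) {t : ℝ} (ht : 0 ≤ t) (i j : ι) :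
    0 ≤ (t • (1 : Matrix ι ι ℝ) - F)⁻¹ i j := by
  set N := F + α • (1 : Matrix ι ι ℝ) with hNdef
  set T := |α| + ‖N‖ + 1 with hT
  -- For large `t` the matrix is `(t + α) • (1 - (t + α)⁻¹ • N)` with `N` nonnegative, and the
  -- Neumann series converges.
  have hbase : ∀ t, T ≤ t → ∀ i j, 0 ≤ (t • (1 : Matrix ι ι ℝ) - F)⁻¹ i j := by
    intro t hTt i j
    have hpos : ‖N‖ < t + α := by linarith [neg_abs_le α]
    have hpos' : 0 < t + α := (norm_nonneg _).trans_lt hpos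
    have h1 : t • (1 : Matrix ι ι ℝ) - F = (t + α) • (1 - (t + α)⁻¹ • N) := by
      rw [smul_sub, smul_smul, mul_inv_cancel₀ hpos'.ne', one_smul, hNdef, add_smul]
      abel
    have h2 : ‖(t + α)⁻¹ • N‖ < 1 := by
      rw [norm_smul, Real.norm_of_nonneg (inv_nonneg.mpr hpos'.le), inv_mul_lt_one₀ hpos']
      exact hpos
    have hu : IsUnit (1 - (t + α)⁻¹ • N) := isUnit_one_sub_of_norm_lt_one h2
    have h3 : ((t + α) • (1 - (t + α)⁻¹ • N))⁻¹ = (t + α)⁻¹ • (1 - (t + α)⁻¹ • N)⁻¹ := by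
      have := Matrix.inv_smul' (A := 1 - (t + α)⁻¹ • N) (Units.mk0 _ hpos'.ne')
        ((Matrix.isUnit_iff_isUnit_det _).mp hu)
      simpa [Units.smul_def] using this
    rw [h1, h3, Matrix.smul_apply, smul_eq_mul]
    refine mul_nonneg (inv_nonneg.mpr hpos'.le) (inv_one_sub_entry_nonneg (fun i j => ?_) h2 i j)
    exact mul_nonneg (inv_nonneg.mpr hpos'.le) (hN i j)
  obtain ⟨K, hK⟩ := (isCompact_Icc (a := (0 : ℝ)) (b := T + 1)).exists_bound_of_continuousOn
    ((continuousOn_inv_smul_one_sub hF).mono fun x hx => hx.1)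
  -- A step below the reciprocal of the resolvent bound on `[0, T + 1]`; `ε ≤ 1` keeps `t + ε` in
  -- that interval when `t < T`.
  set ε := (max K 1 + 1)⁻¹ with hε
  have hε0 : 0 < ε := by positivity
  have hε1 : ε ≤ 1 := inv_le_one_of_one_le₀ (by linarith [le_max_right K 1])
  have hstep : ∀ (r : ℕ) (t : ℝ), 0 ≤ t → T ≤ t + r * ε →
      ∀ i j, 0 ≤ (t • (1 : Matrix ι ι ℝ) - F)⁻¹ i j := by
    intro r
    induction r with
    | zero => intro t _ h; exact hbase t (by simpa using h)
    | succ r ih =>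
      intro t ht h i j
      rcases le_or_gt T t with hTt | hTt
      · exact hbase t hTt i j
      have ih' := ih (t + ε) (by positivity) (by push_cast at h; linarith)
      set R := ((t + ε) • (1 : Matrix ι ι ℝ) - F)⁻¹ with hR
      have hdet := (Matrix.isUnit_iff_isUnit_det _).mp
        (hF.isUnit_real_sub (t := t + ε) (by positivity))
      have h2 : ‖ε • R‖ < 1 := by
        rw [norm_smul, Real.norm_of_nonneg hε0.le, hε, inv_mul_lt_one₀ (by positivity)]
        have := hK (t + ε) ⟨by positivity, by linarith⟩
        linarith [le_max_left K 1]
      -- Nonnegativity descends from `t + ε` to `t`: both factors have nonnegative inverses, the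
      -- first by a Neumann series.
      have h3 : t • (1 : Matrix ι ι ℝ) - F =
          (1 - ε • R) * ((t + ε) • (1 : Matrix ι ι ℝ) - F) := by
        rw [sub_mul, Matrix.one_mul, Matrix.smul_mul, hR, Matrix.nonsing_inv_mul _ hdet, add_smul]
        abel
      rw [h3, Matrix.mul_inv_rev]
      exact mul_entry_nonneg ih' (inv_one_sub_entry_nonneg
        (fun i j => mul_nonneg hε0.le (ih' i j)) h2) i j
  obtain ⟨r, hr⟩ := exists_nat_gt (T / ε)
  exact hstep r t ht (by rw [div_lt_iff₀ hε0] at hr; linarith) i j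

lemma exists_pos_forall_mul_lt {a : Type} [Finite a] (w b : a → ℝ) (hb : ∀ i, 0 < b i) :
    ∃ ε > 0, ∀ i, ε * w i < b i := by
  have h : ∀ᶠ ε in 𝓝[>] (0 : ℝ), ∀ i, ε * w i < b i := by
    refine eventually_all.mpr fun i => ?_
    have hc : Tendsto (fun ε : ℝ => ε * w i) (𝓝[>] 0) (𝓝 (0 * w i)) :=
      ((continuous_id.mul continuous_const).tendsto 0).mono_left nhdsWithin_le_nhds
    exact hc.eventually_lt_const (by simpa using hb i)
  obtain ⟨ε, h1, h2⟩ := (h.and self_mem_nhdsWithin).exists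
  exact ⟨ε, h2, h1⟩

lemma norm_le_norm_toC {a b : Type} [Fintype a] [Fintype b] [DecidableEq b] (M : Matrix a b ℝ) :
    ‖M‖ ≤ ‖toC M‖ := by
  rw [l2_opNorm_def]
  refine ContinuousLinearMap.opNorm_le_bound _ (norm_nonneg _) fun x => ?_
  have h := l2_opNorm_mulVec (toC M) (WithLp.toLp 2 fun i => (x i : ℂ))
  have h1 : ∀ i, (toC M *ᵥ fun i => (x i : ℂ)) i = (((M *ᵥ fun i => x i) i : ℝ) : ℂ) := by
    intro i; simp [mulVec, dotProduct]
  simp only [EuclideanSpace.norm_eq] at h ⊢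
  simpa [h1] using h

/-- The linear program of a positive system with gain less than `δ` is feasible. -/
theorem exists_lp {u y : Type} [Fintype u] [DecidableEq u] [Fintype y] [DecidableEq y]
    {F : Matrix ι ι ℝ} {G : Matrix ι u ℝ}
    {H : Matrix y ι ℝ} {J : Matrix y u ℝ} {δ α : ℝ} (hF : IsHurwitz F)
    (hN : ∀ i j, 0 ≤ (F + α • (1 : Matrix ι ι ℝ)) i j) (hG : ∀ i j, 0 ≤ G i j)
    (hH : ∀ i j, 0 ≤ H i j) (hJ : ∀ i j, 0 ≤ J i j) (hδ : hinfNorm (transferFn F G H J) < δ) :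
    ∃ (d e : ι → ℝ) (g : y → ℝ) (f : u → ℝ),
      ((∀ i, 0 < d i) ∧ (∀ i, 0 < e i) ∧ (∀ q, 0 < g q) ∧ ∀ l, 0 < f l) ∧
      (∀ i, (F *ᵥ d + G *ᵥ f) i < 0) ∧ (∀ q, (H *ᵥ d + J *ᵥ f) q ≤ g q) ∧
      (∀ i, (Fᵀ *ᵥ e + Hᵀ *ᵥ g) i < 0) ∧ ∀ l, (Gᵀ *ᵥ e + Jᵀ *ᵥ g) l < δ ^ 2 * f l := by
  have hδ0 : 0 < δ := (hinfNorm_nonneg _).trans_lt hδ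
  set X := (-F)⁻¹ with hXdef
  have hu : IsUnit (-F) := by simpa using hF.isUnit_real_sub (t := 0) le_rfl
  have hdet := (Matrix.isUnit_iff_isUnit_det _).mp hu
  have hX : ∀ i j, 0 ≤ X i j := by
    intro i j
    simpa using resolvent_entry_nonneg hF hN (t := 0) le_rfl i j
  have hFX : F * X = -1 := by
    have := Matrix.mul_nonsing_inv _ hdet
    rw [Matrix.neg_mul] at this
    rw [← this, neg_neg]
  have hXF : X * F = -1 := by
    have := Matrix.nonsing_inv_mul _ hdet
    rw [Matrix.mul_neg] at this
    rw [← this, neg_neg]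
  -- A zero entry would force a zero row of `X`, contradicting `X * F = -1`.
  have hXpos : ∀ v : ι → ℝ, (∀ i, 0 < v i) → ∀ i, 0 < (X *ᵥ v) i := by
    intro v hv i
    refine lt_of_le_of_ne (mulVec_nonneg_of_nonneg hX (fun j => (hv j).le) i) fun h => ?_
    have h1 := (Finset.sum_eq_zero_iff_of_nonneg
      (fun l _ => mul_nonneg (hX i l) (hv l).le)).mp h.symm
    have h2 : (X * F) i i = 0 := by
      rw [Matrix.mul_apply]
      refine Finset.sum_eq_zero fun l hl => ?_
      rw [(mul_eq_zero.mp (h1 l hl)).resolve_right (hv l).ne', zero_mul]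
    rw [hXF] at h2
    simp at h2
  have hXTpos : ∀ v : ι → ℝ, (∀ i, 0 < v i) → ∀ i, 0 < (Xᵀ *ᵥ v) i := by
    intro v hv i
    refine lt_of_le_of_ne (mulVec_nonneg_of_nonneg (fun i j => hX j i) (fun j => (hv j).le) i)
      fun h => ?_
    have h1 := (Finset.sum_eq_zero_iff_of_nonneg
      (fun l _ => mul_nonneg (hX l i) (hv l).le)).mp h.symm
    have h2 : (F * X) i i = 0 := by
      rw [Matrix.mul_apply]
      refine Finset.sum_eq_zero fun l hl => ?_
      rw [(mul_eq_zero.mp (h1 l hl)).resolve_right (hv l).ne', mul_zero]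
    rw [hFX] at h2
    simp at h2
  set M := H * X * G + J with hMdef
  have hM : ∀ i j, 0 ≤ M i j := fun i j =>
    add_nonneg (mul_entry_nonneg (mul_entry_nonneg hH hX) hG i j) (hJ i j)
  -- `M` is the transfer function at frequency zero.
  have hMnorm : ‖M‖ < δ := by
    refine ((norm_le_norm_toC M).trans ?_).trans_lt hδ
    have h0 := norm_transferFn_le hF G H J 0
    have h1 : resolventMat F (Complex.I * (0 : ℝ)) = toC X := by
      refine Matrix.inv_eq_right_inv ?_
      have : Complex.I * ((0 : ℝ) : ℂ) = 0 := by simp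
      rw [this, zero_smul, zero_sub, Matrix.neg_mul, ← toC_mul, hFX]
      ext i j
      by_cases hij : i = j <;> simp [hij, Matrix.one_apply]
    have h2 : transferFn F G H J (Complex.I * (0 : ℝ)) = toC M := by
      rw [transferFn, h1, ← toC_mul, ← toC_mul]
      ext i j; simp [hMdef]
    rwa [h2] at h0
  set N := (δ ^ 2)⁻¹ • (Mᵀ * M) with hNdef
  have hNnn : ∀ i j, 0 ≤ N i j := fun i j =>
    mul_nonneg (by positivity) (mul_entry_nonneg (fun i j => hM j i) hM i j)
  have hNnorm : ‖N‖ < 1 := by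
    rw [hNdef, norm_smul, Real.norm_of_nonneg (by positivity), inv_mul_lt_one₀ (by positivity)]
    have h1 := l2_opNorm_conjTranspose_mul_self M
    rw [conjTranspose_eq_transpose_of_trivial] at h1
    rw [h1, ← sq]
    exact pow_lt_pow_left₀ hMnorm (norm_nonneg _) two_ne_zero
  have hdetN := (Matrix.isUnit_iff_isUnit_det _).mp (isUnit_one_sub_of_norm_lt_one hNnorm)
  -- The source term `1` in `f = 1 + N *ᵥ f` gives positivity and the slack `δ ^ 2` in `Mᵀ *ᵥ (M *ᵥ
  -- f) < δ ^ 2 • f`.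
  set f : u → ℝ := (1 - N)⁻¹ *ᵥ 1 with hf
  have hf0 : ∀ l, 0 ≤ f l :=
    mulVec_nonneg_of_nonneg (inv_one_sub_entry_nonneg hNnn hNnorm) (fun _ => zero_le_one)
  have hfN : f = 1 + N *ᵥ f := by
    have h1 : (1 - N) *ᵥ f = 1 := by
      rw [hf, mulVec_mulVec, Matrix.mul_nonsing_inv _ hdetN, one_mulVec]
    rw [sub_mulVec, one_mulVec] at h1
    rw [← h1, sub_add_cancel]
  have hfpos : ∀ l, 0 < f l := by
    intro l
    rw [hfN]
    exact add_pos_of_pos_of_nonneg one_pos (mulVec_nonneg_of_nonneg hNnn hf0 l)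
  have hMMf : ∀ l, (Mᵀ *ᵥ (M *ᵥ f)) l = δ ^ 2 * f l - δ ^ 2 := by
    intro l
    have h1 := congrFun hfN l
    rw [hNdef, smul_mulVec, ← mulVec_mulVec] at h1
    simp only [Pi.add_apply, Pi.one_apply, Pi.smul_apply, smul_eq_mul] at h1
    field_simp at h1
    linarith
  -- Raising `M *ᵥ f` by `η` makes `g` positive and uses only part of the slack `δ ^ 2`. Then `ε₁`,
  -- perturbing `d`, is paid for by `η`, and `ε₂`, perturbing `e`, by the slack left in the input
  -- row.
  obtain ⟨η, hη, hηM⟩ := exists_pos_forall_mul_lt (Mᵀ *ᵥ (1 : y → ℝ)) (fun _ => δ ^ 2)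
    (fun _ => by positivity)
  set g : y → ℝ := M *ᵥ f + η • 1 with hg
  have hgpos : ∀ q, 0 < g q := by
    intro q
    simpa [hg] using add_pos_of_nonneg_of_pos (mulVec_nonneg_of_nonneg hM hf0 q) hη
  have hMg : ∀ l, 0 < δ ^ 2 * f l - (Mᵀ *ᵥ g) l := by
    intro l
    rw [hg, mulVec_add, mulVec_smul, Pi.add_apply, hMMf, Pi.smul_apply, smul_eq_mul]
    linarith [hηM l]
  obtain ⟨ε₁, hε₁, h₁⟩ := exists_pos_forall_mul_lt (H *ᵥ (X *ᵥ (1 : ι → ℝ))) (fun _ => η)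
    (fun _ => hη)
  obtain ⟨ε₂, hε₂, h₂⟩ := exists_pos_forall_mul_lt (Gᵀ *ᵥ (Xᵀ *ᵥ (1 : ι → ℝ)))
    (fun l => δ ^ 2 * f l - (Mᵀ *ᵥ g) l) hMg
  refine ⟨X *ᵥ (G *ᵥ f + ε₁ • 1), Xᵀ *ᵥ (Hᵀ *ᵥ g + ε₂ • 1), g, f,
    ⟨hXpos _ fun i => ?_, hXTpos _ fun i => ?_, hgpos, hfpos⟩, fun i => ?_, fun q => ?_,
    fun i => ?_, fun l => ?_⟩
  · simpa using add_pos_of_nonneg_of_pos (mulVec_nonneg_of_nonneg hG hf0 i) hε₁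
  · simpa using add_pos_of_nonneg_of_pos
      (mulVec_nonneg_of_nonneg (M := Hᵀ) (fun i j => hH j i) (fun q => (hgpos q).le) i) hε₂
  · rw [mulVec_mulVec, hFX]
    simp [neg_mulVec, hε₁]
  · have h3 : H *ᵥ (X *ᵥ (G *ᵥ f + ε₁ • 1)) + J *ᵥ f =
        M *ᵥ f + ε₁ • (H *ᵥ (X *ᵥ (1 : ι → ℝ))) := by
      simp only [hMdef, mulVec_add, add_mulVec, mulVec_smul, ← mulVec_mulVec]
      abel
    rw [h3, hg]
    simp only [Pi.add_apply, Pi.smul_apply, smul_eq_mul, Pi.one_apply, mul_one]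
    linarith [h₁ q]
  · rw [mulVec_mulVec, ← transpose_mul, hXF]
    simp [neg_mulVec, hε₂]
  · have h3 : Gᵀ *ᵥ (Xᵀ *ᵥ (Hᵀ *ᵥ g + ε₂ • 1)) + Jᵀ *ᵥ g =
        Mᵀ *ᵥ g + ε₂ • (Gᵀ *ᵥ (Xᵀ *ᵥ (1 : ι → ℝ))) := by
      simp only [hMdef, mulVec_add, add_mulVec, mulVec_smul, transpose_add, transpose_mul,
        ← mulVec_mulVec]
      abel
    rw [h3]
    simp only [Pi.add_apply, Pi.smul_apply, smul_eq_mul]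
    linarith [h₂ l]

end PositiveSystems

/-! ### Estimates for scalar multipliers -/

section ScaledIdentities

/-- The case `r = 0` holds by the conventions for inverses, so zero blocks need no separate
treatment here. -/
lemma inv_smul_one {a : Type} [Fintype a] [DecidableEq a] (r : ℝ) :
    (r • (1 : Matrix a a ℝ))⁻¹ = r⁻¹ • 1 := by
  rcases eq_or_ne r 0 with rfl | hr
  · simp
  · exact Matrix.inv_eq_left_inv (by simp [smul_smul, hr])

lemma mul_inv_smul_one_mul {a b c : Type} [Fintype b] [DecidableEq b] (r : ℝ)
    (M : Matrix a b ℝ) (N : Matrix b c ℝ) :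
    M * (r • (1 : Matrix b b ℝ))⁻¹ * N = r⁻¹ • (M * N) := by
  rw [inv_smul_one, Matrix.mul_smul, Matrix.mul_one, Matrix.smul_mul]

lemma posSemidef_smul_one {a : Type} [Fintype a] [DecidableEq a] {r : ℝ} (hr : 0 ≤ r) :
    (r • (1 : Matrix a a ℝ)).PosSemidef :=
  PosSemidef.one.smul hr

lemma posDef_smul_one {a : Type} [Fintype a] [DecidableEq a] {r : ℝ} (hr : 0 < r) :
    (r • (1 : Matrix a a ℝ)).PosDef :=
  PosDef.one.smul hr

lemma posSemidef_norm_sq_sub {a b : Type} [Fintype a] [Fintype b] [DecidableEq b]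
    (C : Matrix a b ℝ) : (‖C‖ ^ 2 • (1 : Matrix b b ℝ) - Cᵀ * C).PosSemidef := by
  refine PosSemidef.of_dotProduct_mulVec_nonneg ?_ fun x => ?_
  · simp [IsHermitian]
  · have h := l2_opNorm_mulVec C (WithLp.toLp 2 x)
    have h1 := pow_le_pow_left₀ (norm_nonneg _) h 2
    rw [mul_pow, EuclideanSpace.norm_sq_eq, EuclideanSpace.norm_sq_eq] at h1
    have h2 : star x ⬝ᵥ ((‖C‖ ^ 2 • (1 : Matrix b b ℝ) - Cᵀ * C) *ᵥ x) =
        ‖C‖ ^ 2 * (x ⬝ᵥ x) - (C *ᵥ x) ⬝ᵥ (C *ᵥ x) := by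
      rw [sub_mulVec, dotProduct_sub, smul_mulVec, one_mulVec, dotProduct_smul, ← mulVec_mulVec,
        dotProduct_mulVec (star x), vecMul_transpose, star_trivial, smul_eq_mul]
    rw [h2, sub_nonneg]
    simpa [dotProduct, sq] using h1

/-- The weights are balanced so that the difference is a nonnegative multiple of `‖C‖ ^ 2 • 1 - Cᵀ *
C`. It serves both the output terms of the Riccati inequality and the Schur complement for `D`. -/
lemma posSemidef_smul_one_sub {a b : Type} [Fintype a] [DecidableEq a] [Fintype b] [DecidableEq b]
    (C : Matrix a b ℝ) {x y : ℝ} (hx : 0 < x) (hy : 0 < y) :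
    ((specNorm C * y / x) • (1 : Matrix b b ℝ) -
      Cᵀ * ((specNorm C * x / y) • (1 : Matrix a a ℝ))⁻¹ * C).PosSemidef := by
  rw [mul_inv_smul_one_mul]
  change ((‖C‖ * y / x) • (1 : Matrix b b ℝ) - (‖C‖ * x / y)⁻¹ • (Cᵀ * C)).PosSemidef
  have h : (‖C‖ * y / x) • (1 : Matrix b b ℝ) - (‖C‖ * x / y)⁻¹ • (Cᵀ * C) =
      (‖C‖ * x / y)⁻¹ • (‖C‖ ^ 2 • (1 : Matrix b b ℝ) - Cᵀ * C) := by
    rw [smul_sub, smul_smul]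
    congr 2
    rcases eq_or_ne ‖C‖ 0 with h0 | h0
    · simp [h0]
    · field_simp
  rw [h]
  exact (posSemidef_norm_sq_sub C).smul (by positivity)

lemma posSemidef_fromBlocks_norm {a b : Type} [Fintype a] [DecidableEq a] [Fintype b]
    [DecidableEq b] (D : Matrix a b ℝ) {x y : ℝ} (hx : 0 < x) (hy : 0 < y) :
    (fromBlocks ((specNorm D * y / x) • (1 : Matrix b b ℝ)) (-Dᵀ) (-D)
      ((specNorm D * x / y) • (1 : Matrix a a ℝ))).PosSemidef := by
  -- The Schur complement needs a positive definite lower block, so `D = 0` is treated apart.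
  rcases eq_or_ne ‖D‖ 0 with h0 | h0
  · have h1 : specNorm D = 0 := h0
    have h2 : D = 0 := norm_eq_zero.mp h0
    rw [h1, h2]
    simpa using PosSemidef.zero
  · have hpos : 0 < specNorm D := lt_of_le_of_ne (norm_nonneg D) h0.symm
    have hPD : ((specNorm D * x / y) • (1 : Matrix a a ℝ)).PosDef :=
      posDef_smul_one (by positivity)
    have hinv := hPD.isUnit.invertible
    have h := (PosDef.fromBlocks₂₂ ((specNorm D * y / x) • (1 : Matrix b b ℝ)) (-Dᵀ) hPD).mpr (by
      simpa using posSemidef_smul_one_sub D hx hy)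
    simpa using h

lemma toC_mul_inv_smul_one_mul {ι b : Type} [Fintype b] [DecidableEq b] (N : Matrix ι b ℝ) (r : ℝ) :
    toC (N * (r • (1 : Matrix b b ℝ))⁻¹ * Nᵀ) = r⁻¹ • (toC N * (toC N)ᴴ) := by
  rw [mul_inv_smul_one_mul, conjTranspose_toC, ← toC_mul]
  ext i j
  simp

lemma posSemidef_toC_quad {ι b : Type} [Fintype ι] [Fintype b] [DecidableEq b] (N : Matrix ι b ℝ) {r : ℝ} (hr : 0 ≤ r) :
    (toC (N * (r • (1 : Matrix b b ℝ))⁻¹ * Nᵀ)).PosSemidef := by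
  rw [toC_mul_inv_smul_one_mul]
  exact (posSemidef_self_mul_conjTranspose _).smul (inv_nonneg.mpr hr)

variable {ι b : Type} [Fintype ι] [DecidableEq ι] [Fintype b] [DecidableEq b]

/-- The product `(R N)(R N)ᴴ` contributes `h ^ 2` and the inverse multiplier removes one factor `h`,
leaving a bound linear in the gain, as a row of the linear program requires. -/
lemma norm_resolventMat_quad_le {A : Matrix ι ι ℝ} (hA : IsHurwitz A) (N : Matrix ι b ℝ)
    {x y : ℝ} (hx : 0 < x) (hy : 0 < y) (ω : ℝ) {h : ℝ}
    (hh : h = hinfNorm fun s => resolventMat A s * toC N) :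
    ‖resolventMat A (Complex.I * ω) * toC (N * ((h * x / y) • (1 : Matrix b b ℝ))⁻¹ * Nᵀ) *
      (resolventMat A (Complex.I * ω))ᴴ‖ ≤ h * y / x := by
  have hh0 : 0 ≤ h := hh ▸ hinfNorm_nonneg _
  have h1 := norm_resolventMat_mul_le hA N ω
  rw [← hh] at h1
  set R := resolventMat A (Complex.I * ω)
  have h2 : R * toC (N * ((h * x / y) • (1 : Matrix b b ℝ))⁻¹ * Nᵀ) * Rᴴ =
      (h * x / y)⁻¹ • ((R * toC N) * (R * toC N)ᴴ) := by
    rw [toC_mul_inv_smul_one_mul, conjTranspose_mul, Matrix.mul_smul, Matrix.smul_mul]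
    simp only [Matrix.mul_assoc]
  rw [h2, norm_smul, Real.norm_of_nonneg (by positivity)]
  have h3 : ‖(R * toC N) * (R * toC N)ᴴ‖ ≤ h ^ 2 := by
    refine (l2_opNorm_mul _ _).trans ?_
    rw [l2_opNorm_conjTranspose, ← sq]
    exact pow_le_pow_left₀ (norm_nonneg _) h1 2
  refine (mul_le_mul_of_nonneg_left h3 (by positivity)).trans (le_of_eq ?_)
  rcases eq_or_ne h 0 with h0 | h0
  · simp [h0]
  · field_simp

end ScaledIdentities

/-! ### From the linear program to the block inequalities -/

namespace PartitionedSystem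

variable {n ni no : ℕ} {k : Fin n → ℕ} {m : Fin ni → ℕ} {p : Fin no → ℕ}
  (S : PartitionedSystem k m p)

lemma F_self (i : Fin n) : S.F i i = -1 := by simp [F]

lemma F_of_ne {i j : Fin n} (h : i ≠ j) : S.F i j =
    hinfNorm fun s => resolventMat (blk S.A i i) s * toC (blk S.A i j) := by simp [F, h]

lemma G_apply (i : Fin n) (l : Fin ni) : S.G i l =
    hinfNorm fun s => resolventMat (blk S.A i i) s * toC (blk S.B i l) := rfl

lemma F_nonneg {i j : Fin n} (h : i ≠ j) : 0 ≤ S.F i j := by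
  rw [S.F_of_ne h]; exact hinfNorm_nonneg _

lemma G_nonneg (i : Fin n) (l : Fin ni) : 0 ≤ S.G i l := by
  rw [G_apply]; exact hinfNorm_nonneg _

lemma H_nonneg (q : Fin no) (i : Fin n) : 0 ≤ S.H q i := norm_nonneg (blk S.C q i)

lemma J_nonneg (q : Fin no) (l : Fin ni) : 0 ≤ S.J q l := norm_nonneg (blk S.D q l)

lemma F_add_one_nonneg (i j : Fin n) : 0 ≤ (S.F + (1 : ℝ) • (1 : Matrix (Fin n) (Fin n) ℝ)) i j := by
  rcases eq_or_ne i j with rfl | h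
  · simp [F_self]
  · simpa [h] using S.F_nonneg h

lemma G_pos (hA : ∀ i, IsHurwitz (blk S.A i i)) {i : Fin n} {l : Fin ni} (hl : l ∈ S.setL i) :
    0 < S.G i l := by
  refine lt_of_le_of_ne (S.G_nonneg i l) fun h => ?_
  have h1 := (hinfNorm_resolventMat_mul_eq_zero_iff (hA i) (blk S.B i l)).mp h.symm
  simp [setL, h1, specNorm] at hl

lemma F_pos (hA : ∀ i, IsHurwitz (blk S.A i i)) {i j : Fin n} (hj : j ∈ S.setI i) :
    i ≠ j ∧ 0 < S.F i j := by
  simp only [setI, Finset.mem_filter, Finset.mem_univ, true_and] at hj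
  refine ⟨hj.2.symm, lt_of_le_of_ne (S.F_nonneg hj.2.symm) fun h => ?_⟩
  rw [S.F_of_ne hj.2.symm] at h
  have h1 := (hinfNorm_resolventMat_mul_eq_zero_iff (hA i) (blk S.A i j)).mp h.symm
  simp [h1, specNorm] at hj

lemma H_pos {i : Fin n} {q : Fin no} (hq : q ∈ S.setK i) : 0 < S.H q i := by
  simp only [setK, Finset.mem_filter, Finset.mem_univ, true_and] at hq
  exact lt_of_le_of_ne (S.H_nonneg q i) hq.symm

namespace LPSolution

variable {S} {δ : ℝ} {d e : Fin n → ℝ} {g : Fin no → ℝ} {f : Fin ni → ℝ}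

lemma state_sum (hS : S.LPSolution δ d e g f) (i : Fin n) :
    ∑ j ∈ Finset.univ.erase i, S.F i j * d j + ∑ l, S.G i l * f l < d i := by
  have h := hS.state i
  simp only [Pi.add_apply, mulVec, dotProduct] at h
  rw [← Finset.add_sum_erase _ _ (Finset.mem_univ i), F_self] at h
  linarith

lemma costate_sum (hS : S.LPSolution δ d e g f) (i : Fin n) :
    ∑ j ∈ Finset.univ.erase i, S.F j i * e j + ∑ q, S.H q i * g q < e i := by
  have h := hS.costate i
  simp only [Pi.add_apply, mulVec, dotProduct, transpose_apply] at h
  rw [← Finset.add_sum_erase _ _ (Finset.mem_univ i), F_self] at h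
  linarith

/-- The blockwise bounds add up to the off-diagonal part of the state row divided by `e i`, which is
below `d i / e i`: exactly the small gain condition with constant term `e i / d i`. -/
lemma exists_riccati (hA : ∀ i, IsHurwitz (blk S.A i i)) (hS : S.LPSolution δ d e g f)
    (i : Fin n) : ∃ X : Matrix (Fin (k i)) (Fin (k i)) ℝ, X.PosDef ∧ S.BlockRiccatiEq d e f i X := by
  have hd := hS.d_pos
  have he := hS.e_pos
  have hf := hS.f_pos
  have hquad : toC (S.quadTerm (S.lpΦ d e) (S.lpΓ e f) i) =
      ∑ j ∈ S.setI i, toC (blk S.A i j * (S.lpΦ d e i j)⁻¹ * (blk S.A i j)ᵀ) +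
      ∑ l ∈ S.setL i, toC (blk S.B i l * (S.lpΓ e f i l)⁻¹ * (blk S.B i l)ᵀ) := by
    change Complex.ofRealHom.mapMatrix _ = _
    rw [quadTerm, map_add, map_sum, map_sum]
    rfl
  refine exists_posDef_riccati (hA i) ?_ (div_pos (he i) (hd i)) fun ω => ?_
  · rw [hquad]
    refine PosSemidef.add (posSemidef_sum _ fun j _ => posSemidef_toC_quad _ ?_)
      (posSemidef_sum _ fun l _ => posSemidef_toC_quad _ ?_)
    · exact div_nonneg (mul_nonneg (abs_nonneg _) (he i).le) (hd j).le
    · exact div_nonneg (mul_nonneg (S.G_nonneg i l) (he i).le) (hf l).le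
  · rw [hquad, div_mul_eq_mul_div, div_lt_one (hd i), ← lt_div_iff₀' (he i)]
    set R := resolventMat (blk S.A i i) (Complex.I * ω) with hR
    change ‖R * (_ + _) * Rᴴ‖ < _
    rw [Matrix.mul_add, Matrix.add_mul, Matrix.mul_sum, Matrix.mul_sum, Matrix.sum_mul,
      Matrix.sum_mul]
    have h1 : ∀ j ∈ S.setI i, ‖R * toC (blk S.A i j * (S.lpΦ d e i j)⁻¹ * (blk S.A i j)ᵀ) * Rᴴ‖ ≤
        S.F i j * d j / e i := by
      intro j hj
      obtain ⟨hij, hpos⟩ := S.F_pos hA hj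
      rw [lpΦ, abs_of_pos hpos]
      exact norm_resolventMat_quad_le (hA i) _ (he i) (hd j) ω (S.F_of_ne hij)
    have h2 : ∀ l ∈ S.setL i, ‖R * toC (blk S.B i l * (S.lpΓ e f i l)⁻¹ * (blk S.B i l)ᵀ) * Rᴴ‖ ≤
        S.G i l * f l / e i :=
      fun l _ => norm_resolventMat_quad_le (hA i) _ (he i) (hf l) ω (S.G_apply i l)
    have h3 : ∑ j ∈ S.setI i, S.F i j * d j / e i ≤
        ∑ j ∈ Finset.univ.erase i, S.F i j * d j / e i := by
      refine Finset.sum_le_sum_of_subset_of_nonneg (fun j hj => ?_) fun j hj _ => ?_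
      · exact Finset.mem_erase.mpr ⟨(S.F_pos hA hj).1.symm, Finset.mem_univ j⟩
      · exact div_nonneg (mul_nonneg (S.F_nonneg (Finset.ne_of_mem_erase hj).symm) (hd j).le)
          (he i).le
    have h4 : ∑ l ∈ S.setL i, S.G i l * f l / e i ≤ ∑ l, S.G i l * f l / e i :=
      Finset.sum_le_sum_of_subset_of_nonneg (Finset.subset_univ _) fun l _ _ =>
        div_nonneg (mul_nonneg (S.G_nonneg i l) (hf l).le) (he i).le
    refine (norm_add_le _ _).trans_lt ?_
    refine (add_le_add ((norm_sum_le_of_le _ h1).trans h3)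
      ((norm_sum_le_of_le _ h2).trans h4)).trans_lt ?_
    rw [← Finset.sum_div, ← Finset.sum_div, ← add_div]
    exact div_lt_div_of_pos_right (hS.state_sum i) (he i)

/-- The constant term `e i / d i` of the equation pays for the `Φ` terms and for scalar majorants of
the `C` terms; by the costate row divided by `d i`, a remainder `r > 0` is left. -/
lemma riccati_inequality (hS : S.LPSolution δ d e g f)
    (i : Fin n) {X : Matrix (Fin (k i)) (Fin (k i)) ℝ} (hX : S.BlockRiccatiEq d e f i X) :
    LoewnerGT 0
      (X * blk S.A i i + (blk S.A i i).transpose * X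
        + ∑ j ∈ Finset.univ.erase i, S.lpΦ d e j i
        + ∑ q ∈ S.setK i, (blk S.C q i).transpose * (S.lpΞ d g q i)⁻¹ * blk S.C q i
        + X * S.quadTerm (S.lpΦ d e) (S.lpΓ e f) i * X) := by
  have hd := hS.d_pos i
  have hsum : ∑ j ∈ Finset.univ.erase i, S.lpΦ d e j i =
      (∑ j ∈ Finset.univ.erase i, S.F j i * e j / d i) • (1 : Matrix (Fin (k i)) (Fin (k i)) ℝ) := by
    rw [Finset.sum_smul]
    refine Finset.sum_congr rfl fun j hj => ?_
    rw [lpΦ, abs_of_nonneg (S.F_nonneg (Finset.ne_of_mem_erase hj))]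
  set r := e i / d i - ∑ j ∈ Finset.univ.erase i, S.F j i * e j / d i -
    ∑ q ∈ S.setK i, S.H q i * g q / d i with hr
  have hr0 : 0 < r := by
    have h1 : ∑ q ∈ S.setK i, S.H q i * g q / d i ≤ ∑ q, S.H q i * g q / d i :=
      Finset.sum_le_sum_of_subset_of_nonneg (Finset.subset_univ _) fun q _ _ =>
        div_nonneg (mul_nonneg (S.H_nonneg q i) (hS.g_pos q).le) hd.le
    have h2 := div_lt_div_of_pos_right (hS.costate_sum i) hd
    rw [add_div, Finset.sum_div, Finset.sum_div] at h2
    linarith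
  have heq : 0 - (X * blk S.A i i + (blk S.A i i).transpose * X
        + ∑ j ∈ Finset.univ.erase i, S.lpΦ d e j i
        + ∑ q ∈ S.setK i, (blk S.C q i).transpose * (S.lpΞ d g q i)⁻¹ * blk S.C q i
        + X * S.quadTerm (S.lpΦ d e) (S.lpΓ e f) i * X) =
      r • (1 : Matrix (Fin (k i)) (Fin (k i)) ℝ) +
      ∑ q ∈ S.setK i, ((S.H q i * g q / d i) • (1 : Matrix (Fin (k i)) (Fin (k i)) ℝ) -
        (blk S.C q i).transpose * (S.lpΞ d g q i)⁻¹ * blk S.C q i) := by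
    rw [hsum, Finset.sum_sub_distrib, ← Finset.sum_smul, hr, sub_smul, sub_smul]
    have h := hX
    rw [BlockRiccatiEq, ← eq_sub_iff_add_eq, zero_sub, ← eq_sub_iff_add_eq] at h
    rw [h]
    abel
  rw [LoewnerGT, heq]
  exact (posDef_smul_one hr0).add_posSemidef (posSemidef_sum _ fun q _ =>
    posSemidef_smul_one_sub (blk S.C q i) hd (hS.g_pos q))

/-- The scaled identities built from a solution of the linear program are feasible. -/
theorem feasible (hA : ∀ i, IsHurwitz (blk S.A i i)) (hS : S.LPSolution δ d e g f)
    {P : (i : Fin n) → Matrix (Fin (k i)) (Fin (k i)) ℝ}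
    (hP : ∀ i, (P i).PosDef ∧ S.BlockRiccatiEq d e f i (P i)) :
    S.Feasible δ P (S.lpΞ d g) (S.lpΓ e f) (S.lpΦ d e) (S.lpΥ g f) (S.lpΛ g f) := by
  have hd := hS.d_pos
  have he := hS.e_pos
  have hg := hS.g_pos
  have hf := hS.f_pos
  refine
    { posDef_P := fun i => (hP i).1
      psd_Ξ := fun q i => posSemidef_smul_one
        (div_nonneg (mul_nonneg (S.H_nonneg q i) (hd i).le) (hg q).le)
      psd_Γ := fun i l => posSemidef_smul_one
        (div_nonneg (mul_nonneg (S.G_nonneg i l) (he i).le) (hf l).le)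
      psd_Φ := fun i j => posSemidef_smul_one
        (div_nonneg (mul_nonneg (abs_nonneg _) (he i).le) (hd j).le)
      psd_Υ := fun q l => posSemidef_smul_one
        (div_nonneg (mul_nonneg (S.J_nonneg q l) (hg q).le) (hf l).le)
      psd_Λ := fun q l => posSemidef_smul_one
        (div_nonneg (mul_nonneg (S.J_nonneg q l) (hf l).le) (hg q).le)
      Ξ_pos := fun i q hq => posDef_smul_one (div_pos (mul_pos (S.H_pos hq) (hd i)) (hg q))
      Γ_pos := fun i l hl => posDef_smul_one (div_pos (mul_pos (S.G_pos hA hl) (he i)) (hf l))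
      Φ_pos := fun i j hj => posDef_smul_one
        (div_pos (mul_pos (abs_pos.mpr (S.F_pos hA hj).2.ne') (he i)) (hd j))
      riccati := fun i => hS.riccati_inequality i (hP i).2
      coupling_D := fun q l => ?_
      coupling_out := fun q => ?_
      coupling_in := fun l => ?_ }
  · rw [LoewnerGE, sub_zero]
    exact posSemidef_fromBlocks_norm (blk S.D q l) (hf l) (hg q)
  · have h := hS.output q
    simp only [Pi.add_apply, mulVec, dotProduct] at h
    -- Everything is a multiple of the identity, so this coupling is the output row divided by `g
    -- q`; the next one is likewise the input row divided by `f l`.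
    have heq : 1 - (∑ i, S.lpΞ d g q i + ∑ l, S.lpΛ g f q l) =
        (1 - (∑ i, S.H q i * d i + ∑ l, S.J q l * f l) / g q) •
          (1 : Matrix (Fin (p q)) (Fin (p q)) ℝ) := by
      simp only [lpΞ, lpΛ]
      rw [← Finset.sum_smul, ← Finset.sum_smul, ← add_smul, sub_smul, one_smul, add_div,
        Finset.sum_div, Finset.sum_div]
    rw [LoewnerGE, heq]
    exact posSemidef_smul_one (sub_nonneg.mpr ((div_le_one (hg q)).mpr h))
  · have h := hS.input l
    simp only [Pi.add_apply, mulVec, dotProduct, transpose_apply] at h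
    have heq : δ ^ 2 • (1 : Matrix (Fin (m l)) (Fin (m l)) ℝ) -
        (∑ i, S.lpΓ e f i l + ∑ q, S.lpΥ g f q l) =
        (δ ^ 2 - (∑ i, S.G i l * e i + ∑ q, S.J q l * g q) / f l) •
          (1 : Matrix (Fin (m l)) (Fin (m l)) ℝ) := by
      simp only [lpΓ, lpΥ]
      rw [← Finset.sum_smul, ← Finset.sum_smul, ← add_smul, sub_smul, add_div,
        Finset.sum_div, Finset.sum_div]
    rw [LoewnerGT, heq]
    exact posDef_smul_one (sub_pos.mpr ((div_lt_iff₀ (hf l)).mpr h))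

end LPSolution

theorem exists_lpSolution (S : PartitionedSystem k m p) {δ : ℝ} (hF : IsHurwitz S.F)
    (hδ : hinfNorm (transferFn S.F S.G S.H S.J) < δ) :
    ∃ d e g f, S.LPSolution δ d e g f := by
  obtain ⟨d, e, g, f, ⟨hd, he, hg, hf⟩, h1, h2, h3, h4⟩ :=
    exists_lp hF S.F_add_one_nonneg S.G_nonneg S.H_nonneg S.J_nonneg hδ
  exact ⟨d, e, g, f, ⟨hd, he, hg, hf, h1, h2, h3, h4⟩⟩

end PartitionedSystem

end BlockRiccati

theorem mainTheorem8 {n ni no : ℕ} (k : Fin n → ℕ) (m : Fin ni → ℕ) (p : Fin no → ℕ)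
    (S : BlockRiccati.PartitionedSystem k m p) (δ : ℝ)
    (hA : ∀ i, BlockRiccati.IsHurwitz (BlockRiccati.blk S.A i i))
    (hF : BlockRiccati.IsHurwitz S.F)
    (hδ : BlockRiccati.hinfNorm (BlockRiccati.transferFn S.F S.G S.H S.J) < δ) :
    (∃ P Ξ Γ Φ Υ Λ, S.Feasible δ P Ξ Γ Φ Υ Λ) ∧
    (∃ d e g f, S.LPSolution δ d e g f) ∧
    (∀ d e g f, S.LPSolution δ d e g f →
      (∀ i, ∃ X : Matrix (Fin (k i)) (Fin (k i)) ℝ,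
        X.PosDef ∧ S.BlockRiccatiEq d e f i X) ∧
      (∀ P : (i : Fin n) → Matrix (Fin (k i)) (Fin (k i)) ℝ,
        (∀ i, (P i).PosDef ∧ S.BlockRiccatiEq d e f i (P i)) →
        S.Feasible δ P (S.lpΞ d g) (S.lpΓ e f) (S.lpΦ d e) (S.lpΥ g f) (S.lpΛ g f))) := by
  refine ⟨?_, S.exists_lpSolution hF hδ, fun d e g f hS =>
    ⟨hS.exists_riccati hA, fun P hP => hS.feasible hA hP⟩⟩
  obtain ⟨d, e, g, f, hS⟩ := S.exists_lpSolution hF hδ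
  choose P hP using hS.exists_riccati hA
  exact ⟨P, _, _, _, _, _, hS.feasible hA hP⟩
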